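/- Let $\mathcal K\subset\mathbb R^{2\times 2}$ be nonempty and compact, let $\Omega\subset\mathbb R^2$ be a bounded open set with Lipschitz boundary, and let $\Gamma\subset\partial\Omega$ be nonempty, relatively open and $C^3$ regular (near each point of $\Gamma$, after a rigid motion, $\Omega$ is the region on one side of the graph of a $C^3$ function). Let $\tau:\Gamma\to\mathbb R^2$ be a $C^2$ unit tangent vector field to $\Gamma$. Assume $$d:=\min_{x\in\bar\Gamma}\ \min_{K\in\mathcal K}|K\tau(x)-\tau(x)|>0,$$ where, at points $x\in\bar\Gamma\setminus\Gamma$, $\tau(x)$ stands for every limit of values $\tau(x_n)$ along sequences $\Gamma\ni x_n\to x$. Then there is a constant $c>0$, depending only on $\mathcal K$, $\Omega$, $\Gamma$, such that for every $\epsilon>0$ and every $u\in W^{1,2}(\Omega;\mathbb R^2)$ whose boundary trace satisfies $$\operatorname{osc}_{\tilde\Gamma}(u-\mathrm{id})\le\frac{d}{208}\,\mathcal H^1(\tilde\Gamma)\qquad\text{for every relatively open connected }\tilde\Gamma\subset\Gamma,$$ one has $$E_\epsilon(u,\Omega):=\int_\Omega\operatorname{dist}^2(\nabla u,\mathcal K)\,dx+\epsilon\,|D^2u|(\Omega)\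 \ge\ c\,\min\{1,\epsilon(|\log\epsilon|+1)\}.$$ Here $\operatorname{osc}_{\tilde\Gamma}(v):=\operatorname{ess\,sup}_{x_1,x_2\in\tilde\Gamma}|v|_{\partial\Omega}(x_1)-v|_{\partial\Omega}(x_2)|$ with $v|_{\partial\Omega}$ the trace of $v$ and the essential supremum taken with respect to $\mathcal H^1$. The distance is taken in the Frobenius norm. $|D^2u|(\Omega)\in[0,\infty]$ is the total variation of $\nabla u$ in $\Omega$, equal to $+\infty$ if $\nabla u$ is not of bounded variation in $\Omega$. -/

import Mathlib

open MeasureTheory Filter Topology Set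
open scoped ENNReal NNReal ContDiff

noncomputable section

/-- The Euclidean plane. -/
abbrev Plane : Type := EuclideanSpace ℝ (Fin 2)

/-- Real `2 × 2` matrices. -/
abbrev Mat2 : Type := Matrix (Fin 2) (Fin 2) ℝ

/-- The vector `A x`. -/
def matVec (A : Mat2) (x : Plane) : Plane := Matrix.toEuclideanLin A x

/-- The partial derivative `∂_j f (x)` of a scalar function on the plane. -/
def partialDeriv (j : Fin 2) (f : Plane → ℝ) (x : Plane) : ℝ :=
  fderiv ℝ f x (EuclideanSpace.single j 1)

/-! ### Domains -/

/-- Near `p`, and after a rotation or reflection `L` of the plane, the set `Ω` is the part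
`{(x, y) : x > h y}` of the plane that lies on one side of the graph of `h`. -/
def IsLocalEpigraph (Ω : Set Plane) (p : Plane) (h : ℝ → ℝ) : Prop :=
  ∃ L : Plane ≃ₗᵢ[ℝ] Plane, ∃ ρ : ℝ, 0 < ρ ∧
    ∀ q ∈ Metric.ball p ρ, (q ∈ Ω ↔ h ((L q) 1) < (L q) 0)

/-- Bounded open sets of the plane with Lipschitz boundary. Connectedness is not required. -/
structure IsBoundedLipschitzDomain (Ω : Set Plane) : Prop where
  isOpen : IsOpen Ω
  isBounded : Bornology.IsBounded Ω
  lipschitz : ∀ p ∈ frontier Ω, ∃ h : ℝ → ℝ, (∃ C : ℝ≥0, LipschitzWith C h) ∧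
    IsLocalEpigraph Ω p h

/-- `Γ` is a relatively open subset of `S`. -/
def IsRelOpen (Γ S : Set Plane) : Prop := ∃ V : Set Plane, IsOpen V ∧ Γ = S ∩ V

/-- `Γ` is a relatively open portion of the boundary of `Ω`, of class `C³`. -/
structure IsC3BoundaryPortion (Ω Γ : Set Plane) : Prop where
  isRelOpen : IsRelOpen Γ (frontier Ω)
  regular : ∀ p ∈ Γ, ∃ h : ℝ → ℝ, ContDiff ℝ 3 h ∧ IsLocalEpigraph Ω p h

/-- `τ` (restricted to `Γ`) is a unit tangent vector field to `Γ` of class `C²`. -/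
structure IsC2UnitTangentField (Γ : Set Plane) (τ : Plane → Plane) : Prop where
  contDiffOn : ContDiffOn ℝ 2 τ Γ
  norm_eq_one : ∀ x ∈ Γ, ‖τ x‖ = 1
  tangent : ∀ x ∈ Γ, τ x ∈ tangentConeAt ℝ Γ x

/-- The set of all numbers `|K τ(x) - τ(x)|` with `x` in the closure of `Γ` and `K` a well.
The field `τ` lives on `Γ`. At the other points `x` of the closure, `τ(x)` stands for the limits
of `τ` at `x`: the pairs `(x, t)` below form the closure of the graph of `τ` over `Γ`. If `τ` is
continuous on the closure of `Γ`, these are the pairs `(x, τ x)` with `x` in the closure of `Γ`. -/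
def tangentialMismatch (𝒦 : Set Mat2) (Γ : Set Plane) (τ : Plane → Plane) : Set ℝ :=
  {r | ∃ x t : Plane, (x, t) ∈ closure {z : Plane × Plane | z.1 ∈ Γ ∧ z.2 = τ z.1} ∧
    ∃ K ∈ 𝒦, r = ‖matVec K t - t‖}

/-! ### Sobolev functions and traces -/

/-- `u` belongs to `W^{1,2}(Ω; ℝ²)`, with weak gradient `G`, where `G x i j = ∂_j u_i (x)`. -/
structure IsSobolevW12 (Ω : Set Plane) (u : Plane → Plane) (G : Plane → Mat2) : Prop where
  memLp : MemLp u 2 (volume.restrict Ω)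
  memLp_grad : ∀ i j, MemLp (fun x => G x i j) 2 (volume.restrict Ω)
  weak_grad : ∀ φ : Plane → ℝ, ContDiff ℝ ∞ φ → HasCompactSupport φ → tsupport φ ⊆ Ω →
    ∀ i j, ∫ x in Ω, u x i * partialDeriv j φ x = - ∫ x in Ω, G x i j * φ x

/-- The length measure (one-dimensional Hausdorff measure) on a subset `S` of the plane. -/
def lengthOn (S : Set Plane) : Measure Plane := (Measure.hausdorffMeasure 1).restrict S

/-- `g` is the boundary trace of the Sobolev function `u` with weak gradient `G`: there are `C¹`
functions on the plane that converge to `u` in `W^{1,2}(Ω)` and whose restrictions to the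
boundary converge to `g` in `L²(∂Ω)`. -/
def IsTrace (Ω : Set Plane) (u : Plane → Plane) (G : Plane → Mat2) (g : Plane → Plane) : Prop :=
  MemLp g 2 (lengthOn (frontier Ω)) ∧
  ∃ w : ℕ → Plane → Plane, (∀ n, ContDiff ℝ 1 (w n)) ∧
    Tendsto (fun n => eLpNorm (fun x => w n x - u x) 2 (volume.restrict Ω)) atTop (𝓝 0) ∧
    (∀ i j, Tendsto
      (fun n => eLpNorm (fun x => partialDeriv j (fun y => w n y i) x - G x i j) 2
        (volume.restrict Ω)) atTop (𝓝 0)) ∧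
    Tendsto (fun n => eLpNorm (fun x => w n x - g x) 2 (lengthOn (frontier Ω))) atTop (𝓝 0)

/-- The oscillation `ess sup_{x₁, x₂ ∈ Γ} |v(x₁) - v(x₂)|` of `v` on a subset `Γ` of a curve. -/
def traceOsc (Γ : Set Plane) (v : Plane → Plane) : ℝ≥0∞ :=
  essSup (fun z : Plane × Plane => ‖v z.1 - v z.2‖ₑ) ((lengthOn Γ).prod (lengthOn Γ))

/-! ### The energy -/

section

open scoped Matrix.Norms.Frobenius

/-- The squared distance `dist²(A, 𝒦)` for the Frobenius (Euclidean) norm of matrices. -/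
def distSq (A : Mat2) (𝒦 : Set Mat2) : ℝ≥0∞ := Metric.infEDist A 𝒦 ^ 2

end

/-- The total variation `|DG|(Ω)` of a matrix field `G`, that is, the supremum of
`∑ ∫_Ω G_{ij} ∂_k φ_{ijk}` over all compactly supported `C¹` tensor fields `φ` on `Ω` with
Euclidean norm at most one. It is infinite when `G` has no bounded variation in `Ω`. -/
def totalVariation (Ω : Set Plane) (G : Plane → Mat2) : ℝ≥0∞ :=
  ⨆ φ ∈ {φ : Fin 2 → Fin 2 → Fin 2 → Plane → ℝ |
      (∀ i j k, ContDiff ℝ 1 (φ i j k) ∧ HasCompactSupport (φ i j k) ∧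
        tsupport (φ i j k) ⊆ Ω) ∧
      ∀ x, ∑ i, ∑ j, ∑ k, φ i j k x ^ 2 ≤ 1},
    ENNReal.ofReal (∑ i, ∑ j, ∑ k, ∫ x in Ω, G x i j * partialDeriv k (φ i j k) x)

/-- The energy `E_ε(u, Ω) = ∫_Ω dist²(∇u, 𝒦) dx + ε |D²u|(Ω)` of a Sobolev function `u` with
weak gradient `G = ∇u`. -/
def energy (𝒦 : Set Mat2) (Ω : Set Plane) (ε : ℝ) (G : Plane → Mat2) : ℝ≥0∞ :=
  (∫⁻ x in Ω, distSq (G x) 𝒦) + ENNReal.ofReal ε * totalVariation Ω G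

end

/-! The boundary condition contradicts a constant gradient in `𝒦` at every scale near `Γ`, and each
dyadic scale has to pay for this separately.

Near a point of `Γ` the boundary is the graph of `h`, with slope close to a fixed `m`. With `b =
L.symm (m, 1)` one has `d |b| ≤ |K b - b|` for every `K ∈ 𝒦`, while the trace follows the identity
along each arc up to a small oscillation. Take a cell of size `y`: a parallelogram of length `N y`
along the line of slope `m`, at heights between `y` and `2 y`. If `∇u` were close to a single `K`
there, `u` would change by about `N y K b` across the cell, but the trace changes by about `N y b`.
Passing from the boundary to the cell costs two vertical paths of length `O(y)`, along which `∇u` is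
controlled by the size `R` of `𝒦` and the elastic energy. If `N` is large compared with `R / d` this
cost is absorbed, and `exists_cell_energy_bound` gives `c y² ≤ y |D²u|(cell) + ∫ dist²(∇u, 𝒦)`, the
integral being over the column that joins the cell to the boundary.

Use `8 ^ k` cells of size `y₀ / 8 ^ k` for each `k < n`. Adding over one scale gives `c y₀ ≤ ∑
|D²u|(cells) + (8 ^ k / y₀) ∫ dist²`. Cells of different scales lie at disjoint heights, so their
total variations add up to at most `|D²u|(Ω)`. The columns overlap, so the elastic energy is counted
at every scale, but with geometric weights. Hence `n c y₀ ≤ |D²u|(Ω) + (8 ^ n / y₀) ∫ dist²`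
(`sum_cells_le`), and `8 ^ n ∼ 1 / ε` produces the logarithm (`exists_log_lower_bound`).

In place of a Poincaré inequality, the double integral of `|∇u(q) - ∇u(x)|` over a cell is bounded
through translations and duality. The fundamental theorem of calculus is applied to the `C¹`
functions that define the trace, and the resulting `L¹` estimates pass to the limit. -/

/-! ### Total variation -/

/-- The compactly supported `C¹` tensor fields of norm at most one on `U`. -/
def IsTVTest (U : Set Plane) (φ : Fin 2 → Fin 2 → Fin 2 → Plane → ℝ) : Prop :=
  (∀ i j k, ContDiff ℝ 1 (φ i j k) ∧ HasCompactSupport (φ i j k) ∧ tsupport (φ i j k) ⊆ U) ∧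
    ∀ x, ∑ i, ∑ j, ∑ k, φ i j k x ^ 2 ≤ 1

theorem IsTVTest.mono {U V : Set Plane} (h : U ⊆ V) {φ : Fin 2 → Fin 2 → Fin 2 → Plane → ℝ}
    (hφ : IsTVTest U φ) : IsTVTest V φ :=
  ⟨fun i j k => ⟨(hφ.1 i j k).1, (hφ.1 i j k).2.1, (hφ.1 i j k).2.2.trans h⟩, hφ.2⟩

theorem isTVTest_zero (U : Set Plane) : IsTVTest U (fun _ _ _ _ => 0) := by
  refine ⟨fun i j k => ⟨contDiff_const, ?_, ?_⟩, by simp⟩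
  · exact HasCompactSupport.zero
  · have : tsupport (fun _ : Plane => (0 : ℝ)) = ∅ := by
      rw [tsupport_eq_empty_iff]; rfl
    rw [this]; exact empty_subset _

/-- The pairing of a matrix field with the divergence of a tensor field. -/
noncomputable def tvPairing (G : Plane → Mat2) (φ : Fin 2 → Fin 2 → Fin 2 → Plane → ℝ) : ℝ :=
  ∑ i, ∑ j, ∑ k, ∫ x, G x i j * partialDeriv k (φ i j k) x

theorem tsupport_partialDeriv_subset (k : Fin 2) (φ : Plane → ℝ) :
    tsupport (partialDeriv k φ) ⊆ tsupport φ := by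
  refine subset_trans ?_ (tsupport_fderiv_subset ℝ (f := φ))
  refine closure_mono fun x hx => ?_
  contrapose! hx
  simp only [Function.mem_support, not_not] at hx ⊢
  simp [partialDeriv, hx]

theorem continuous_partialDeriv {φ : Plane → ℝ} (hφ : ContDiff ℝ 1 φ) (k : Fin 2) :
    Continuous (partialDeriv k φ) := by
  unfold partialDeriv
  exact (hφ.continuous_fderiv one_ne_zero).clm_apply continuous_const

theorem setIntegral_mul_partialDeriv {U : Set Plane} {φ : Plane → ℝ} (hφ : tsupport φ ⊆ U)
    (f : Plane → ℝ) (k : Fin 2) :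
    ∫ x in U, f x * partialDeriv k φ x = ∫ x, f x * partialDeriv k φ x := by
  apply setIntegral_eq_integral_of_forall_compl_eq_zero
  intro x hx
  rw [image_eq_zero_of_notMem_tsupport
    (fun h => hx (hφ (tsupport_partialDeriv_subset k φ h))), mul_zero]

theorem integrable_mul_partialDeriv {f φ : Plane → ℝ} (hf : Integrable f) (hφ : ContDiff ℝ 1 φ)
    (hc : HasCompactSupport φ) (k : Fin 2) :
    Integrable (fun x => f x * partialDeriv k φ x) := by
  have hcont := continuous_partialDeriv hφ k
  have hs : HasCompactSupport (partialDeriv k φ) :=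
    hc.of_isClosed_subset (isClosed_tsupport _) (tsupport_partialDeriv_subset k φ)
  obtain ⟨C, hC⟩ := hcont.bounded_above_of_compact_support hs
  exact hf.mul_bdd hcont.aestronglyMeasurable (Eventually.of_forall hC)

/-- The fields are supported in `U`, so the integrals may run over the whole plane; the pairing then
no longer depends on the set. -/
theorem totalVariation_eq (U : Set Plane) (G : Plane → Mat2) :
    totalVariation U G = ⨆ φ, ⨆ (_ : IsTVTest U φ), ENNReal.ofReal (tvPairing G φ) := by
  unfold totalVariation
  refine iSup_congr fun φ => ?_
  refine iSup_congr_Prop Iff.rfl fun hφ => ?_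
  unfold tvPairing
  congr 1
  refine Finset.sum_congr rfl fun i _ => Finset.sum_congr rfl fun j _ =>
    Finset.sum_congr rfl fun k _ => ?_
  exact setIntegral_mul_partialDeriv (hφ.1 i j k).2.2 (fun x => G x i j) k

theorem ofReal_tvPairing_le {U : Set Plane} (G : Plane → Mat2)
    {φ : Fin 2 → Fin 2 → Fin 2 → Plane → ℝ} (hφ : IsTVTest U φ) :
    ENNReal.ofReal (tvPairing G φ) ≤ totalVariation U G := by
  rw [totalVariation_eq]
  exact le_iSup₂ (f := fun φ (_ : IsTVTest U φ) => ENNReal.ofReal (tvPairing G φ)) φ hφ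

theorem totalVariation_mono {U V : Set Plane} (h : U ⊆ V) (G : Plane → Mat2) :
    totalVariation U G ≤ totalVariation V G := by
  rw [totalVariation_eq U]
  exact iSup₂_le fun φ hφ => ofReal_tvPairing_le G (hφ.mono h)

theorem totalVariation_congr {U : Set Plane} {G H : Plane → Mat2}
    (h : ∀ᵐ x ∂volume.restrict U, G x = H x) : totalVariation U G = totalVariation U H := by
  unfold totalVariation
  refine iSup_congr fun φ => iSup_congr_Prop Iff.rfl fun _ => ?_
  congr 1
  refine Finset.sum_congr rfl fun i _ => Finset.sum_congr rfl fun j _ =>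
    Finset.sum_congr rfl fun k _ => integral_congr_ae ?_
  filter_upwards [h] with x hx
  rw [hx]

theorem partialDeriv_add {φ ψ : Plane → ℝ} (hφ : ContDiff ℝ 1 φ) (hψ : ContDiff ℝ 1 ψ)
    (k : Fin 2) (x : Plane) :
    partialDeriv k (fun y => φ y + ψ y) x = partialDeriv k φ x + partialDeriv k ψ x := by
  unfold partialDeriv
  rw [fderiv_fun_add (hφ.differentiable one_ne_zero x) (hψ.differentiable one_ne_zero x)]
  rfl

theorem tvPairing_add {G : Plane → Mat2} (hG : ∀ i j, Integrable (fun x => G x i j))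
    {φ ψ : Fin 2 → Fin 2 → Fin 2 → Plane → ℝ} {U V : Set Plane} (hφ : IsTVTest U φ)
    (hψ : IsTVTest V ψ) :
    tvPairing G (fun i j k x => φ i j k x + ψ i j k x) = tvPairing G φ + tvPairing G ψ := by
  unfold tvPairing
  simp only [← Finset.sum_add_distrib]
  refine Finset.sum_congr rfl fun i _ => Finset.sum_congr rfl fun j _ =>
    Finset.sum_congr rfl fun k _ => ?_
  rw [← integral_add (integrable_mul_partialDeriv (hG i j) (hφ.1 i j k).1 (hφ.1 i j k).2.1 k)
    (integrable_mul_partialDeriv (hG i j) (hψ.1 i j k).1 (hψ.1 i j k).2.1 k)]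
  refine integral_congr_ae (Eventually.of_forall fun x => ?_)
  simp only
  rw [partialDeriv_add (hφ.1 i j k).1 (hψ.1 i j k).1, mul_add]

theorem IsTVTest.add {U V : Set Plane} (hUV : Disjoint U V)
    {φ ψ : Fin 2 → Fin 2 → Fin 2 → Plane → ℝ} (hφ : IsTVTest U φ) (hψ : IsTVTest V ψ) :
    IsTVTest (U ∪ V) (fun i j k x => φ i j k x + ψ i j k x) := by
  refine ⟨fun i j k => ⟨(hφ.1 i j k).1.add (hψ.1 i j k).1, (hφ.1 i j k).2.1.add (hψ.1 i j k).2.1,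
    (tsupport_add _ _).trans (union_subset_union (hφ.1 i j k).2.2 (hψ.1 i j k).2.2)⟩, fun x => ?_⟩
  by_cases hx : x ∈ U
  · have : ∀ i j k, ψ i j k x = 0 := fun i j k =>
      image_eq_zero_of_notMem_tsupport fun h => (hUV.notMem_of_mem_left hx) ((hψ.1 i j k).2.2 h)
    simpa [this] using hφ.2 x
  · have : ∀ i j k, φ i j k x = 0 := fun i j k =>
      image_eq_zero_of_notMem_tsupport fun h => hx ((hφ.1 i j k).2.2 h)
    simpa [this] using hψ.2 x

/-- Test fields with disjoint supports can be added without breaking the pointwise bound. Negative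
pairings, which `ENNReal.ofReal` truncates, are treated separately. -/
theorem totalVariation_add_le {G : Plane → Mat2} (hG : ∀ i j, Integrable (fun x => G x i j))
    {U V : Set Plane} (hUV : Disjoint U V) :
    totalVariation U G + totalVariation V G ≤ totalVariation (U ∪ V) G := by
  rw [totalVariation_eq U, totalVariation_eq V]
  refine ENNReal.biSup_add_biSup_le' ⟨_, isTVTest_zero U⟩ ⟨_, isTVTest_zero V⟩ fun φ hφ ψ hψ => ?_
  rcases le_total (tvPairing G φ) 0 with h1 | h1
  · rw [ENNReal.ofReal_of_nonpos h1, zero_add]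
    exact ofReal_tvPairing_le G (hψ.mono subset_union_right)
  rcases le_total (tvPairing G ψ) 0 with h2 | h2
  · rw [ENNReal.ofReal_of_nonpos h2, add_zero]
    exact ofReal_tvPairing_le G (hφ.mono subset_union_left)
  rw [← ENNReal.ofReal_add h1 h2, ← tvPairing_add hG hφ hψ]
  exact ofReal_tvPairing_le G (hφ.add hUV hψ)

theorem sum_totalVariation_le {ι : Type*} {G : Plane → Mat2}
    (hG : ∀ i j, Integrable (fun x => G x i j)) (s : Finset ι) (U : ι → Set Plane)
    (hU : (s : Set ι).PairwiseDisjoint U) :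
    ∑ i ∈ s, totalVariation (U i) G ≤ totalVariation (⋃ i ∈ s, U i) G := by
  classical
  induction s using Finset.induction_on with
  | empty => simp
  | insert a s ha ih =>
    rw [Finset.sum_insert ha, Finset.set_biUnion_insert]
    refine (add_le_add le_rfl (ih (hU.subset (by simp)))).trans (totalVariation_add_le hG ?_)
    refine disjoint_iUnion₂_right.2 fun i hi => hU (by simp) (by simp [hi]) ?_
    rintro rfl
    exact ha hi

/-! ### Translations of functions of bounded variation -/

theorem exists_smooth_cutoff {F V : Set Plane} (hF : IsCompact F) (hV : IsOpen V)
    (hVb : Bornology.IsBounded V) (hFV : F ⊆ V) :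
    ∃ χ : Plane → ℝ, ContDiff ℝ 1 χ ∧ HasCompactSupport χ ∧ tsupport χ ⊆ V ∧
      (∀ x ∈ F, χ x = 1) ∧ ∀ x, χ x ∈ Icc (0 : ℝ) 1 := by
  obtain ⟨f, h0, h1, hf⟩ := exists_contMDiffMap_zero_one_nhds_of_isClosed
    (modelWithCornersSelf ℝ Plane) (n := 1) hV.isClosed_compl hF.isClosed
    (disjoint_compl_left_iff_subset.2 hFV)
  have hts : tsupport f ⊆ V := by
    intro x hx
    by_contra hxV
    have : ∀ᶠ y in 𝓝 x, f y = 0 :=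
      (Filter.eventually_iff_exists_mem.1 h0).elim fun s hs =>
        Filter.mem_of_superset ((mem_nhdsSet_iff_forall.1 hs.1) x hxV) hs.2
    exact (notMem_tsupport_iff_eventuallyEq.2 this) hx
  refine ⟨f, contMDiff_iff_contDiff.1 f.contMDiff, ?_, hts, ?_, hf⟩
  · exact Metric.isCompact_of_isClosed_isBounded (isClosed_tsupport _) (hVb.subset hts)
  · exact fun x hx => h1.self_of_nhdsSet x hx

/-- Duality between `L¹` and the compactly supported `C¹` functions of norm at most one. -/
theorem lintegral_enorm_le_of_forall_test {V : Set Plane} (hV : IsOpen V)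
    (hVb : Bornology.IsBounded V) {f : Plane → ℝ} (hf : Integrable f) {M : ℝ}
    (h : ∀ ψ : Plane → ℝ, ContDiff ℝ 1 ψ → HasCompactSupport ψ → tsupport ψ ⊆ V →
      (∀ x, |ψ x| ≤ 1) → ∫ x, f x * ψ x ≤ M) :
    ∫⁻ x in V, ‖f x‖ₑ ≤ ENNReal.ofReal M := by
  obtain ⟨F, hFc, hFV, hFU, hFm⟩ := hV.exists_iUnion_isClosed
  rw [← hFU, setLIntegral_iUnion_of_directed _ hFm.directed_le]
  refine iSup_le fun n => ?_
  have hFn : IsCompact (F n) :=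
    Metric.isCompact_of_isClosed_isBounded (hFc n) (hVb.subset (hFV n))
  obtain ⟨χ, hχ, hχc, hχV, hχ1, hχI⟩ := exists_smooth_cutoff hFn hV hVb (hFV n)
  have hχb : ∀ x, |χ x| ≤ 1 := fun x => by
    rw [abs_of_nonneg (hχI x).1]; exact (hχI x).2
  have hχi : Integrable χ := hχ.continuous.integrable_of_hasCompactSupport hχc
  have key : ∀ δ : ℝ, 0 < δ → ∫ x, χ x * |f x| ≤ M + (2 * δ + δ * ∫ x, χ x) := by
    intro δ hδ
    obtain ⟨g, hgc, hg, hfg⟩ := (memLp_one_iff_integrable.2 hf).exist_eLpNorm_sub_le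
      ENNReal.one_ne_top le_rfl hδ
    have hg1 : ContDiff ℝ 1 g := hg.of_le (by exact_mod_cast le_top)
    have hgi : Integrable g := hg1.continuous.integrable_of_hasCompactSupport hgc
    have hfgi : Integrable (fun x => |f x - g x|) := (hf.sub hgi).abs
    have hfg' : ∫ x, |f x - g x| ≤ δ := by
      have h1 : ∫ x, |f x - g x| = (eLpNorm (f - g) 1 volume).toReal := by
        rw [eLpNorm_one_eq_lintegral_enorm, ← integral_norm_eq_lintegral_enorm
          (hf.sub hgi).aestronglyMeasurable]
        rfl
      rw [h1]
      exact ENNReal.toReal_le_of_le_ofReal hδ.le hfg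
    -- A `C¹` substitute for `χ · sign g`: it loses at most `δ`, since `g² / √(δ² + g²) ≥ |g| - δ`.
    set ψ : Plane → ℝ := fun x => χ x * (g x / Real.sqrt (δ ^ 2 + g x ^ 2)) with hψ
    have hpos : ∀ x, 0 < δ ^ 2 + g x ^ 2 := fun x => by positivity
    have hq : ∀ x, |g x / Real.sqrt (δ ^ 2 + g x ^ 2)| ≤ 1 := by
      intro x
      rw [abs_div, abs_of_nonneg (Real.sqrt_nonneg _), div_le_one (Real.sqrt_pos.2 (hpos x))]
      exact Real.abs_le_sqrt (by nlinarith [sq_nonneg δ])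
    have hψb : ∀ x, |ψ x| ≤ χ x := fun x => by
      rw [hψ, abs_mul, abs_of_nonneg (hχI x).1]
      exact mul_le_of_le_one_right (hχI x).1 (hq x)
    have hψd : ContDiff ℝ 1 ψ :=
      hχ.mul (hg1.div ((contDiff_const.add (hg1.pow 2)).sqrt fun x => (hpos x).ne')
        fun x => (Real.sqrt_pos.2 (hpos x)).ne')
    have hψc : HasCompactSupport ψ := hχc.mul_right
    have hψV : tsupport ψ ⊆ V := (tsupport_mul_subset_left).trans hχV
    have hψM := h ψ hψd hψc hψV fun x => (hψb x).trans (hχI x).2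
    have hpt : ∀ x, χ x * |f x| ≤ f x * ψ x + (2 * |f x - g x| + δ * χ x) := by
      intro x
      have h1 : |g x| - δ ≤ g x * (g x / Real.sqrt (δ ^ 2 + g x ^ 2)) := by
        rw [← mul_div_assoc, le_div_iff₀ (Real.sqrt_pos.2 (hpos x))]
        have h2 : Real.sqrt (δ ^ 2 + g x ^ 2) ≤ δ + |g x| := by
          rw [Real.sqrt_le_left (by positivity)]
          nlinarith [abs_nonneg (g x), sq_abs (g x)]
        rcases le_total (|g x|) δ with h3 | h3
        · nlinarith [Real.sqrt_nonneg (δ ^ 2 + g x ^ 2), mul_self_nonneg (g x)]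
        · nlinarith [mul_le_mul_of_nonneg_left h2 (sub_nonneg.2 h3), sq_abs (g x)]
      have h4 : χ x * |f x| ≤ χ x * |g x| + |f x - g x| := by
        have := abs_sub_abs_le_abs_sub (f x) (g x)
        nlinarith [(hχI x).1, (hχI x).2, abs_nonneg (f x - g x)]
      have h5 : g x * ψ x ≤ f x * ψ x + |f x - g x| := by
        have h6 : (g x - f x) * ψ x ≤ |f x - g x| := by
          refine (le_abs_self _).trans ?_
          rw [abs_mul, abs_sub_comm]
          exact mul_le_of_le_one_right (abs_nonneg _) ((hψb x).trans (hχI x).2)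
        linarith
      have h7 : χ x * (|g x| - δ) ≤ g x * ψ x := by
        rw [hψ]
        calc χ x * (|g x| - δ) ≤ χ x * (g x * (g x / Real.sqrt (δ ^ 2 + g x ^ 2))) :=
              mul_le_mul_of_nonneg_left h1 (hχI x).1
          _ = _ := by ring
      linarith
    have hi1 : Integrable (fun x => χ x * |f x|) :=
      hf.abs.bdd_mul hχ.continuous.aestronglyMeasurable (Eventually.of_forall hχb)
    have hi2 : Integrable (fun x => f x * ψ x) :=
      hf.mul_bdd hψd.continuous.aestronglyMeasurable
        (Eventually.of_forall fun x => (hψb x).trans (hχI x).2)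
    have hi3 : Integrable (fun x => 2 * |f x - g x| + δ * χ x) :=
      (hfgi.const_mul 2).add (hχi.const_mul δ)
    calc ∫ x, χ x * |f x| ≤ ∫ x, (f x * ψ x + (2 * |f x - g x| + δ * χ x)) :=
          integral_mono hi1 (hi2.add hi3) hpt
      _ = (∫ x, f x * ψ x) + (2 * (∫ x, |f x - g x|) + δ * ∫ x, χ x) := by
          rw [integral_add hi2 hi3, integral_add (hfgi.const_mul 2) (hχi.const_mul δ),
            integral_const_mul, integral_const_mul]
      _ ≤ _ := by linarith
  have hlim : ∫ x, χ x * |f x| ≤ M := by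
    have ht : Tendsto (fun δ : ℝ => M + (2 * δ + δ * ∫ x, χ x)) (𝓝[>] 0)
        (𝓝 (M + (2 * 0 + 0 * ∫ x, χ x))) := by
      refine Tendsto.mono_left ?_ nhdsWithin_le_nhds
      exact Continuous.tendsto (by fun_prop) 0
    have := ge_of_tendsto ht (eventually_mem_nhdsWithin.mono fun δ hδ => key δ hδ)
    simpa using this
  have hi1 : Integrable (fun x => χ x * |f x|) :=
    hf.abs.bdd_mul hχ.continuous.aestronglyMeasurable (Eventually.of_forall hχb)
  calc ∫⁻ x in F n, ‖f x‖ₑ ≤ ∫⁻ x in F n, ENNReal.ofReal (χ x * |f x|) := by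
        refine setLIntegral_mono' (hFc n).measurableSet fun x hx => ?_
        rw [hχ1 x hx, one_mul, Real.enorm_eq_ofReal_abs]
    _ ≤ ∫⁻ x, ENNReal.ofReal (χ x * |f x|) := setLIntegral_le_lintegral _ _
    _ = ENNReal.ofReal (∫ x, χ x * |f x|) :=
        (ofReal_integral_eq_lintegral_ofReal hi1 (Eventually.of_forall fun x =>
          mul_nonneg (hχI x).1 (abs_nonneg _))).symm
    _ ≤ ENNReal.ofReal M := ENNReal.ofReal_le_ofReal hlim

theorem fderiv_apply_eq_sum_partialDeriv (ψ : Plane → ℝ) (x v : Plane) :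
    fderiv ℝ ψ x v = ∑ k, v k * partialDeriv k ψ x := by
  have hv : v = ∑ k, v k • EuclideanSpace.single k (1 : ℝ) := by
    ext i; fin_cases i <;> simp
  conv_lhs => rw [hv]
  simp [partialDeriv]

/-- Use the tensor field whose only nonzero row is `(v / |v|) ψ`, in the entry `(i, j)`: its
Euclidean norm is `|ψ|` and its divergence is the derivative of `ψ` along `v / |v|`. -/
theorem integral_mul_fderiv_le {U : Set Plane} {G : Plane → Mat2}
    (hG : ∀ i j, Integrable (fun x => G x i j)) (hT : totalVariation U G ≠ ⊤) (i j : Fin 2)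
    {ψ : Plane → ℝ} (hψ : ContDiff ℝ 1 ψ) (hψc : HasCompactSupport ψ) (hψU : tsupport ψ ⊆ U)
    (hψ1 : ∀ x, |ψ x| ≤ 1) (v : Plane) :
    ∫ x, G x i j * fderiv ℝ ψ x v ≤ ‖v‖ * (totalVariation U G).toReal := by
  rcases eq_or_ne v 0 with rfl | hv
  · simp
  have hv0 : 0 < ‖v‖ := norm_pos_iff.2 hv
  set c : Fin 2 → Fin 2 → Fin 2 → ℝ := fun i' j' k => if i' = i ∧ j' = j then v k / ‖v‖ else 0
    with hc
  set φ : Fin 2 → Fin 2 → Fin 2 → Plane → ℝ := fun i' j' k x => c i' j' k * ψ x with hφ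
  have hsum : ∀ F : Fin 2 → Fin 2 → Fin 2 → ℝ, ∑ i', ∑ j', ∑ k, c i' j' k * F i' j' k =
      ∑ k, v k / ‖v‖ * F i j k := by
    intro F
    rw [Finset.sum_eq_single i, Finset.sum_eq_single j]
    · simp [hc]
    · intro b _ hb; simp [hc, hb]
    · simp
    · intro b _ hb; simp [hc, hb]
    · simp
  have hnorm : ∑ k, v k ^ 2 = ‖v‖ ^ 2 := by
    rw [EuclideanSpace.norm_sq_eq]; simp
  have htest : IsTVTest U φ := by
    refine ⟨fun i' j' k => ⟨contDiff_const.mul hψ, hψc.mul_left,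
      (tsupport_mul_subset_right).trans hψU⟩, fun x => ?_⟩
    have h1 : ∑ i', ∑ j', ∑ k, φ i' j' k x ^ 2 = ψ x ^ 2 := by
      have : ∀ i' j' k, φ i' j' k x ^ 2 = c i' j' k * (c i' j' k * ψ x ^ 2) := by
        intro i' j' k; simp only [hφ]; ring
      simp only [this]
      rw [hsum (fun i' j' k => c i' j' k * ψ x ^ 2)]
      have : ∀ k, v k / ‖v‖ * (c i j k * ψ x ^ 2) = v k ^ 2 * (ψ x ^ 2 / ‖v‖ ^ 2) := by
        intro k; simp only [hc, and_self, if_true]; field_simp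
      simp only [this]
      rw [← Finset.sum_mul, hnorm]
      field_simp
    rw [h1]
    exact (sq_le_one_iff_abs_le_one _).2 (hψ1 x)
  have hpair : tvPairing G φ = (∫ x, G x i j * fderiv ℝ ψ x v) / ‖v‖ := by
    have h1 : ∀ i' j' k, ∫ x, G x i' j' * partialDeriv k (φ i' j' k) x =
        c i' j' k * ∫ x, G x i' j' * partialDeriv k ψ x := by
      intro i' j' k
      rw [← integral_const_mul]
      refine integral_congr_ae (Eventually.of_forall fun x => ?_)
      simp only [hφ, partialDeriv]
      rw [fderiv_const_mul (hψ.differentiable one_ne_zero x)]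
      simp; ring
    unfold tvPairing
    simp only [h1]
    rw [hsum (fun i' j' k => ∫ x, G x i' j' * partialDeriv k ψ x)]
    have h2 : (fun x => G x i j * fderiv ℝ ψ x v) =
        fun x => ∑ k, v k * (G x i j * partialDeriv k ψ x) := by
      funext x
      rw [fderiv_apply_eq_sum_partialDeriv, Finset.mul_sum]
      refine Finset.sum_congr rfl fun k _ => by ring
    rw [h2, integral_finsetSum _ fun k _ =>
      (integrable_mul_partialDeriv (hG i j) hψ hψc k).const_mul _, Finset.sum_div]
    refine Finset.sum_congr rfl fun k _ => ?_
    rw [integral_const_mul]; ring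
  have := ofReal_tvPairing_le G htest
  rw [hpair, ENNReal.ofReal_le_iff_le_toReal hT, div_le_iff₀ hv0] at this
  linarith

theorem abs_integral_mul_fderiv_le {U : Set Plane} {G : Plane → Mat2}
    (hG : ∀ i j, Integrable (fun x => G x i j)) (hT : totalVariation U G ≠ ⊤) (i j : Fin 2)
    {ψ : Plane → ℝ} (hψ : ContDiff ℝ 1 ψ) (hψc : HasCompactSupport ψ) (hψU : tsupport ψ ⊆ U)
    (hψ1 : ∀ x, |ψ x| ≤ 1) (v : Plane) :
    |∫ x, G x i j * fderiv ℝ ψ x v| ≤ ‖v‖ * (totalVariation U G).toReal := by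
  refine abs_le'.2 ⟨integral_mul_fderiv_le hG hT i j hψ hψc hψU hψ1 v, ?_⟩
  have := integral_mul_fderiv_le hG hT i j hψ hψc hψU hψ1 (-v)
  rw [norm_neg] at this
  simpa [integral_neg] using this

/-- Move the translation onto `ψ` and interpolate by `θ ↦ ∫ G ψ(· - θ v)`. Its derivative pairs `G`
with a directional derivative of a translate of `ψ`, so the mean value inequality applies. -/
theorem integral_translate_sub_mul_le {U : Set Plane} (hU : Convex ℝ U) {G : Plane → Mat2}
    (hG : ∀ i j, Integrable (fun x => G x i j)) (hT : totalVariation U G ≠ ⊤) (i j : Fin 2)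
    (v : Plane) {ψ : Plane → ℝ} (hψ : ContDiff ℝ 1 ψ) (hψc : HasCompactSupport ψ)
    (hψU : tsupport ψ ⊆ {x | x ∈ U ∧ x + v ∈ U}) (hψ1 : ∀ x, |ψ x| ≤ 1) :
    ∫ x, (G (x + v) i j - G x i j) * ψ x ≤ ‖v‖ * (totalVariation U G).toReal := by
  set I : ℝ → ℝ := fun θ => ∫ x, G x i j * ψ (x - θ • v) with hI
  have hdiff := hψ.differentiable one_ne_zero
  obtain ⟨C, hC⟩ := (hψ.continuous_fderiv one_ne_zero).bounded_above_of_compact_support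
    (hψc.fderiv ℝ)
  have hcont : ∀ θ : ℝ, Continuous fun x : Plane => ψ (x - θ • v) := fun θ =>
    hψ.continuous.comp (by fun_prop)
  have hderiv : ∀ θ : ℝ, HasDerivAt I (∫ x, G x i j * fderiv ℝ ψ (x - θ • v) (-v)) θ := by
    intro θ
    refine (hasDerivAt_integral_of_dominated_loc_of_deriv_le (μ := volume)
      (F := fun θ x => G x i j * ψ (x - θ • v))
      (F' := fun θ x => G x i j * fderiv ℝ ψ (x - θ • v) (-v))
      (bound := fun x => |G x i j| * (C * ‖v‖)) (s := univ) univ_mem ?_ ?_ ?_ ?_ ?_ ?_).2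
    · exact Eventually.of_forall fun θ =>
        (hG i j).aestronglyMeasurable.mul (hcont θ).aestronglyMeasurable
    · exact (hG i j).mul_bdd (hcont θ).aestronglyMeasurable (c := 1)
        (Eventually.of_forall fun x => hψ1 _)
    · refine (hG i j).aestronglyMeasurable.mul (Continuous.aestronglyMeasurable ?_)
      exact ((hψ.continuous_fderiv one_ne_zero).comp (by fun_prop)).clm_apply continuous_const
    · refine Eventually.of_forall fun x θ _ => ?_
      rw [norm_mul, Real.norm_eq_abs]
      refine mul_le_mul_of_nonneg_left ?_ (abs_nonneg _)
      refine (ContinuousLinearMap.le_opNorm _ _).trans ?_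
      rw [norm_neg]
      exact mul_le_mul_of_nonneg_right (hC _) (norm_nonneg _)
    · exact (hG i j).abs.mul_const _
    · refine Eventually.of_forall fun x θ _ => ?_
      refine HasDerivAt.const_mul _ ?_
      have h1 : HasDerivAt (fun θ : ℝ => x - θ • v) (-v) θ := by
        simpa using ((hasDerivAt_id θ).smul_const v).const_sub x
      exact (hdiff _).hasFDerivAt.comp_hasDerivAt θ h1
  have hbound : ∀ θ ∈ Ico (0 : ℝ) 1, ‖∫ x, G x i j * fderiv ℝ ψ (x - θ • v) (-v)‖ ≤
      ‖v‖ * (totalVariation U G).toReal := by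
    intro θ hθ
    let e : Plane ≃ₜ Plane := Homeomorph.subRight (θ • v)
    have hts : tsupport (ψ ∘ e) = e ⁻¹' tsupport ψ := tsupport_comp_eq_preimage ψ e
    have h1 : ContDiff ℝ 1 (ψ ∘ e) := hψ.comp (contDiff_id.sub contDiff_const)
    have h2 : HasCompactSupport (ψ ∘ e) := hψc.comp_homeomorph e
    -- Convexity enters here: a point of the translated support lies on the segment between two
    -- points of `U`.
    have h3 : tsupport (ψ ∘ e) ⊆ U := by
      rw [hts]
      intro x hx
      obtain ⟨hx1, hx2⟩ := hψU hx
      have hx3 : x - θ • v ∈ U := hx1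
      have hx4 : x - θ • v + v ∈ U := hx2
      have := hU hx3 hx4 (sub_nonneg.2 hθ.2.le) hθ.1 (by ring)
      convert this using 1
      module
    have h4 := abs_integral_mul_fderiv_le hG hT i j h1 h2 h3 (fun x => hψ1 _) (-v)
    rw [norm_neg] at h4
    refine le_of_eq_of_le ?_ h4
    rw [Real.norm_eq_abs]
    congr 1
    refine integral_congr_ae (Eventually.of_forall fun x => ?_)
    simp only
    congr 2
    exact (fderiv_comp_sub (f := ψ) (θ • v)).symm
  have hmv := norm_image_sub_le_of_norm_deriv_le_segment_01'
    (fun θ _ => (hderiv θ).hasDerivWithinAt) hbound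
  have h0 : I 0 = ∫ x, G x i j * ψ x := by simp [hI]
  have h1 : I 1 = ∫ x, G (x + v) i j * ψ x := by
    rw [hI]
    simp only [one_smul]
    rw [← integral_add_right_eq_self _ v]
    simp
  have hi : ∀ w : Plane, Integrable fun x => G (x + w) i j * ψ x := fun w =>
    ((hG i j).comp_add_right w).mul_bdd hψ.continuous.aestronglyMeasurable (c := 1)
      (Eventually.of_forall fun x => hψ1 _)
  have hi0 : Integrable fun x => G x i j * ψ x := by simpa using hi 0
  calc ∫ x, (G (x + v) i j - G x i j) * ψ x
      = I 1 - I 0 := by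
        rw [h0, h1, ← integral_sub (hi v) hi0]
        simp only [sub_mul]
    _ ≤ _ := (le_abs_self _).trans hmv

/-- The `L¹` modulus of continuity of a function of bounded variation. -/
theorem lintegral_enorm_translate_sub_le {U : Set Plane} (hUo : IsOpen U)
    (hUb : Bornology.IsBounded U) (hU : Convex ℝ U) {G : Plane → Mat2}
    (hG : ∀ i j, Integrable (fun x => G x i j)) (i j : Fin 2) (v : Plane) :
    ∫⁻ x in {x | x ∈ U ∧ x + v ∈ U}, ‖G (x + v) i j - G x i j‖ₑ ≤
      ‖v‖ₑ * totalVariation U G := by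
  rcases eq_or_ne v 0 with rfl | hv
  · simp
  rcases eq_or_ne (totalVariation U G) ⊤ with hT | hT
  · rw [hT, ENNReal.mul_top (by simpa using hv)]; exact le_top
  have := lintegral_enorm_le_of_forall_test (V := {x | x ∈ U ∧ x + v ∈ U})
    (hUo.inter (hUo.preimage (continuous_add_const v)))
    (hUb.subset fun x hx => hx.1) (((hG i j).comp_add_right v).sub (hG i j))
    (fun ψ h1 h2 h3 h4 => integral_translate_sub_mul_le hU hG hT i j v h1 h2 h3 h4)
  refine this.trans_eq ?_
  rw [ENNReal.ofReal_mul (norm_nonneg _), ENNReal.ofReal_toReal hT, ofReal_norm]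

/-- Substitute `y = x + v` and exchange the integrals. For fixed `v` the translation estimate
applies, and only `|v| ≤ D` contributes. This replaces the Poincaré inequality. -/
theorem lintegral_lintegral_enorm_sub_le {U : Set Plane} (hUo : IsOpen U)
    (hU : Convex ℝ U) {D : ℝ} (hD : ∀ x ∈ U, ∀ y ∈ U, ‖y - x‖ ≤ D) {G : Plane → Mat2}
    (hG : ∀ i j, Integrable (fun x => G x i j)) (hGm : ∀ i j, Measurable (fun x => G x i j))
    (i j : Fin 2) :
    ∫⁻ x in U, ∫⁻ y in U, ‖G y i j - G x i j‖ₑ ≤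
      volume (Metric.closedBall (0 : Plane) D) * (ENNReal.ofReal D * totalVariation U G) := by
  have hUb : Bornology.IsBounded U := by
    rcases U.eq_empty_or_nonempty with rfl | ⟨x, hx⟩
    · exact Bornology.isBounded_empty
    · exact (Metric.isBounded_closedBall (x := x) (r := D)).subset fun y hy => by
        rw [mem_closedBall_iff_norm]; exact hD x hx y hy
  have hm : Measurable fun z : Plane × Plane => ‖G (z.1 + z.2) i j - G z.1 i j‖ₑ :=
    (((hGm i j).comp (measurable_fst.add measurable_snd)).sub
      ((hGm i j).comp measurable_fst)).enorm
  have hS : MeasurableSet {z : Plane × Plane | z.1 ∈ U ∧ z.1 + z.2 ∈ U} :=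
    (measurable_fst hUo.measurableSet).inter
      ((measurable_fst.add measurable_snd) hUo.measurableSet)
  set F : Plane → Plane → ℝ≥0∞ := fun x v =>
    {z : Plane × Plane | z.1 ∈ U ∧ z.1 + z.2 ∈ U}.indicator
      (fun z => ‖G (z.1 + z.2) i j - G z.1 i j‖ₑ) (x, v) with hF
  have hFm : Measurable (Function.uncurry F) := hm.indicator hS
  calc ∫⁻ x in U, ∫⁻ y in U, ‖G y i j - G x i j‖ₑ
      = ∫⁻ x, ∫⁻ v, F x v := by
        rw [← lintegral_indicator hUo.measurableSet]
        refine lintegral_congr fun x => ?_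
        by_cases hx : x ∈ U
        · rw [indicator_of_mem hx, ← lintegral_indicator hUo.measurableSet,
            ← lintegral_add_left_eq_self _ x]
          refine lintegral_congr fun v => ?_
          by_cases hv : x + v ∈ U <;> simp [hF, indicator, hx, hv]
        · rw [indicator_of_notMem hx]
          simp [hF, indicator, hx]
    _ = ∫⁻ v, ∫⁻ x, F x v := lintegral_lintegral_swap hFm.aemeasurable
    _ ≤ ∫⁻ v in Metric.closedBall (0 : Plane) D, ENNReal.ofReal D * totalVariation U G := by
        rw [← lintegral_indicator Metric.isClosed_closedBall.measurableSet]
        refine lintegral_mono fun v => ?_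
        have hV : MeasurableSet {x | x ∈ U ∧ x + v ∈ U} :=
          (hUo.inter (hUo.preimage (continuous_add_const v))).measurableSet
        have h1 : ∫⁻ x, F x v = ∫⁻ x in {x | x ∈ U ∧ x + v ∈ U}, ‖G (x + v) i j - G x i j‖ₑ := by
          rw [← lintegral_indicator hV]
          refine lintegral_congr fun x => ?_
          simp [hF, indicator]
        by_cases hv : ‖v‖ ≤ D
        · rw [indicator_of_mem (by simpa using hv)]
          simp only
          rw [h1]
          refine (lintegral_enorm_translate_sub_le hUo hUb hU hG i j v).trans ?_
          gcongr
          rw [← ofReal_norm]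
          exact ENNReal.ofReal_le_ofReal hv
        · rw [indicator_of_notMem (by simpa using hv)]
          simp only
          rw [h1]
          have : {x | x ∈ U ∧ x + v ∈ U} = ∅ := by
            ext x
            simp only [mem_ofPred_eq, mem_empty_iff_false, iff_false]
            rintro ⟨hx, hxv⟩
            exact hv (by simpa using hD x hx _ hxv)
          simp [this]
    _ = _ := by rw [setLIntegral_const, mul_comm]

/-! ### Coordinates along a graph -/

/-- The point at height `s` above the point with abscissa `t` of the graph of `α`, in the
coordinates given by the isometry `L`. -/
noncomputable def graphMap (L : Plane ≃ₗᵢ[ℝ] Plane) (α : ℝ → ℝ) (t s : ℝ) : Plane :=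
  L.symm !₂[α t + s, t]

/-- The points above `I` whose height relative to the graph of `α` lies in `J`. -/
def graphSet (L : Plane ≃ₗᵢ[ℝ] Plane) (α : ℝ → ℝ) (I J : Set ℝ) : Set Plane :=
  {q | (L q) 1 ∈ I ∧ (L q) 0 - α ((L q) 1) ∈ J}

section

variable (L : Plane ≃ₗᵢ[ℝ] Plane)

@[simp] theorem apply_graphMap_one (α : ℝ → ℝ) (t s : ℝ) : (L (graphMap L α t s)) 1 = t := by
  simp [graphMap]

@[simp] theorem apply_graphMap_zero (α : ℝ → ℝ) (t s : ℝ) :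
    (L (graphMap L α t s)) 0 = α t + s := by
  simp [graphMap]

theorem graphMap_apply (α : ℝ → ℝ) (q : Plane) :
    graphMap L α ((L q) 1) ((L q) 0 - α ((L q) 1)) = q := by
  apply L.injective
  ext i
  fin_cases i <;> simp

theorem continuous_graphMap {α : ℝ → ℝ} (hα : Continuous α) :
    Continuous fun z : ℝ × ℝ => graphMap L α z.1 z.2 := by
  unfold graphMap
  refine L.symm.continuous.comp ((PiLp.continuous_toLp 2 _).comp (continuous_pi fun i => ?_))
  fin_cases i
  · simp; fun_prop
  · simp; fun_prop

/-- A shear followed by a swap of coordinates and an isometry. -/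
theorem measurePreserving_graphMap {α : ℝ → ℝ} (hα : Continuous α) :
    MeasurePreserving fun z : ℝ × ℝ => graphMap L α z.1 z.2 := by
  have h1 : MeasurePreserving (fun z : ℝ × ℝ => (z.1, α z.1 + z.2)) (volume.prod volume)
      (volume.prod volume) :=
    (MeasurePreserving.id volume).skew_product (g := fun t s => α t + s)
      (by fun_prop) (Eventually.of_forall fun t => (measurePreserving_add_left volume (α t)).map_eq)
  have h2 : MeasurePreserving (Prod.swap : ℝ × ℝ → ℝ × ℝ) (volume.prod volume)
      (volume.prod volume) := Measure.measurePreserving_swap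
  have h3 := (volume_preserving_finTwoArrow ℝ).symm
  have h4 := (EuclideanSpace.volume_preserving_symm_measurableEquiv_toLp (Fin 2)).symm
  have h5 := L.symm.measurePreserving
  have h6 := h5.comp (h4.comp (h3.comp (h2.comp h1)))
  have h7 : (fun z : ℝ × ℝ => graphMap L α z.1 z.2) =
      L.symm ∘ (MeasurableEquiv.toLp 2 (Fin 2 → ℝ)).symm.symm ∘
        (MeasurableEquiv.finTwoArrow (α := ℝ)).symm ∘
          Prod.swap ∘ fun z : ℝ × ℝ => (z.1, α z.1 + z.2) := by
    funext z
    refine congrArg L.symm ?_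
    ext i
    fin_cases i <;> rfl
  rw [h7]
  exact h6

theorem measurableSet_graphSet {α : ℝ → ℝ} (hα : Continuous α) {I J : Set ℝ}
    (hI : MeasurableSet I) (hJ : MeasurableSet J) : MeasurableSet (graphSet L α I J) := by
  have h1 : Continuous fun q : Plane => (L q) 1 := by fun_prop
  have h0 : Continuous fun q : Plane => (L q) 0 - α ((L q) 1) := by fun_prop
  exact (h1.measurable hI).inter (h0.measurable hJ)

theorem isOpen_graphSet {α : ℝ → ℝ} (hα : Continuous α) {I J : Set ℝ}
    (hI : IsOpen I) (hJ : IsOpen J) : IsOpen (graphSet L α I J) := by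
  have h1 : Continuous fun q : Plane => (L q) 1 := by fun_prop
  have h0 : Continuous fun q : Plane => (L q) 0 - α ((L q) 1) := by fun_prop
  exact (hI.preimage h1).inter (hJ.preimage h0)

theorem lintegral_graphSet {α : ℝ → ℝ} (hα : Continuous α) {I J : Set ℝ}
    (hI : MeasurableSet I) (hJ : MeasurableSet J) {F : Plane → ℝ≥0∞} (hF : Measurable F) :
    ∫⁻ q in graphSet L α I J, F q = ∫⁻ t in I, ∫⁻ s in J, F (graphMap L α t s) := by
  have hmp := measurePreserving_graphMap L hα
  rw [← hmp.setLIntegral_comp_preimage (measurableSet_graphSet L hα hI hJ) hF]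
  have hpre : (fun z : ℝ × ℝ => graphMap L α z.1 z.2) ⁻¹' graphSet L α I J = I ×ˢ J := by
    ext z; simp [graphSet]
  rw [hpre, Measure.volume_eq_prod, ← Measure.prod_restrict]
  exact lintegral_prod (fun z : ℝ × ℝ => F (graphMap L α z.1 z.2))
    (hF.comp hmp.measurable).aemeasurable

theorem volume_graphSet {α : ℝ → ℝ} (hα : Continuous α) {I J : Set ℝ}
    (hI : MeasurableSet I) (hJ : MeasurableSet J) :
    volume (graphSet L α I J) = volume I * volume J := by
  have := lintegral_graphSet L hα hI hJ (F := fun _ => 1) measurable_const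
  simpa [mul_comm] using this

theorem graphMap_vertical (α : ℝ → ℝ) (t s : ℝ) :
    graphMap L α t s = graphMap L α t 0 + s • L.symm !₂[1, 0] := by
  apply L.injective
  ext i
  fin_cases i <;> simp [graphMap]

theorem graphMap_affine (α₀ m t₁ t s : ℝ) :
    graphMap L (fun t => α₀ + m * (t - t₁)) t s =
      L.symm !₂[α₀ - m * t₁ + s, 0] + t • L.symm !₂[m, 1] := by
  apply L.injective
  ext i
  fin_cases i
  · simp [graphMap]; ring
  · simp [graphMap]

/-- Cells are bounded by lines rather than by translates of the graph of `h` because the translation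
estimate needs convex sets. -/
theorem convex_graphSet_affine (α₀ m t₁ : ℝ) {I J : Set ℝ} (hI : Convex ℝ I) (hJ : Convex ℝ J) :
    Convex ℝ (graphSet L (fun t => α₀ + m * (t - t₁)) I J) := by
  intro x hx y hy a b ha hb hab
  refine ⟨?_, ?_⟩
  · have := hI hx.1 hy.1 ha hb hab
    simpa using this
  · have := hJ hx.2 hy.2 ha hb hab
    convert this using 1
    simp
    linear_combination (α₀ - m * t₁) * hab

end

/-! ### The fundamental theorem of calculus on cells -/

theorem enorm_sub_sub_smul_le {w : Plane → Plane} (hw : ContDiff ℝ 1 w) (p a v : Plane)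
    {s t : ℝ} (hst : s ≤ t) :
    ‖w (p + t • a) - w (p + s • a) - (t - s) • v‖ₑ ≤
      ∫⁻ r in Icc s t, ‖fderiv ℝ w (p + r • a) a - v‖ₑ := by
  set f : ℝ → Plane := fun r => w (p + r • a) - r • v with hf
  have hfd : ContDiff ℝ 1 f := by
    refine (hw.comp ?_).sub ?_ <;> fun_prop
  have h := enorm_sub_le_lintegral_deriv_of_contDiffOn_Icc (f := f) hfd.contDiffOn hst
  have hder : ∀ r, deriv f r = fderiv ℝ w (p + r • a) a - v := by
    intro r
    have h1 : HasDerivAt (fun r : ℝ => p + r • a) a r := by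
      simpa using ((hasDerivAt_id r).smul_const a).const_add p
    have h2 : HasDerivAt (fun r : ℝ => r • v) v r := by
      simpa using (hasDerivAt_id r).smul_const v
    exact (((hw.differentiable one_ne_zero _).hasFDerivAt.comp_hasDerivAt r h1).sub h2).deriv
  simp only [hder] at h
  refine le_of_eq_of_le ?_ h
  congr 1
  simp only [hf]
  module

theorem continuous_fderiv_apply_const {w : Plane → Plane} (hw : ContDiff ℝ 1 w) (a : Plane) :
    Continuous fun q => fderiv ℝ w q a :=
  (hw.continuous_fderiv one_ne_zero).clm_apply continuous_const

section

variable (L : Plane ≃ₗᵢ[ℝ] Plane)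

theorem enorm_vertical_le {w : Plane → Plane} (hw : ContDiff ℝ 1 w) (h : ℝ → ℝ) {t s H : ℝ}
    (hs : 0 ≤ s) (hsH : s < H) :
    ‖w (graphMap L h t s) - w (graphMap L h t 0)‖ₑ ≤
      ∫⁻ r in Ioo 0 H, ‖fderiv ℝ w (graphMap L h t r) (L.symm !₂[1, 0])‖ₑ := by
  have h1 := enorm_sub_sub_smul_le hw (graphMap L h t 0) (L.symm !₂[1, 0]) 0 hs
  simp only [smul_zero, sub_zero, zero_smul, add_zero, ← graphMap_vertical] at h1
  refine h1.trans ?_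
  rw [← restrict_Ioo_eq_restrict_Icc]
  exact lintegral_mono_set (Ioo_subset_Ioo_right hsH.le)

/-- Join the two boundary points by a vertical segment, a segment of direction `(m, 1)` at height
`σ` above the line, and a second vertical segment; then average over `σ` in `(y, 2 y)`. The graph is
within `y / 2` of the line, so the vertical segments have length less than `3 y`. -/
theorem enorm_boundary_sub_le {w : Plane → Plane} (hw : ContDiff ℝ 1 w) {h : ℝ → ℝ}
    {t₁ y N m : ℝ} (hy : 0 < y)
    (hℓ : ∀ t ∈ Icc t₁ (t₁ + N * y), |h t - (h t₁ + m * (t - t₁))| ≤ y / 2) (v : Plane)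
    {t t' : ℝ} (ht : t ∈ Ioo t₁ (t₁ + N * y)) (ht' : t' ∈ Ioo t₁ (t₁ + N * y)) (htt : t ≤ t') :
    ‖w (graphMap L h t' 0) - w (graphMap L h t 0) - (t' - t) • v‖ₑ ≤
      (ENNReal.ofReal y)⁻¹ * (∫⁻ q in graphSet L (fun t => h t₁ + m * (t - t₁))
          (Ioo t₁ (t₁ + N * y)) (Ioo y (2 * y)), ‖fderiv ℝ w q (L.symm !₂[m, 1]) - v‖ₑ) +
        ((∫⁻ r in Ioo 0 (3 * y), ‖fderiv ℝ w (graphMap L h t r) (L.symm !₂[1, 0])‖ₑ) +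
        ∫⁻ r in Ioo 0 (3 * y), ‖fderiv ℝ w (graphMap L h t' r) (L.symm !₂[1, 0])‖ₑ) := by
  set ℓ : ℝ → ℝ := fun t => h t₁ + m * (t - t₁) with hℓd
  have hℓc : Continuous ℓ := by fun_prop
  set I := Ioo t₁ (t₁ + N * y)
  set P := ‖w (graphMap L h t' 0) - w (graphMap L h t 0) - (t' - t) • v‖ₑ
  set V : ℝ → ℝ≥0∞ := fun t =>
    ∫⁻ r in Ioo 0 (3 * y), ‖fderiv ℝ w (graphMap L h t r) (L.symm !₂[1, 0])‖ₑ with hV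
  set A : ℝ → ℝ≥0∞ := fun σ =>
    ∫⁻ r in I, ‖fderiv ℝ w (graphMap L ℓ r σ) (L.symm !₂[m, 1]) - v‖ₑ with hA
  have hshift : ∀ t s, graphMap L ℓ t s = graphMap L h t (ℓ t - h t + s) := by
    intro t s
    unfold graphMap
    congr 3
    ring
  have hvert : ∀ t ∈ I, ∀ σ ∈ Ioo y (2 * y),
      ‖w (graphMap L ℓ t σ) - w (graphMap L h t 0)‖ₑ ≤ V t := by
    intro t ht σ hσ
    have := abs_le.1 (hℓ t ⟨ht.1.le, ht.2.le⟩)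
    rw [hshift]
    refine enorm_vertical_le L hw h ?_ ?_
    · simp only [hℓd]; linarith [hσ.1]
    · simp only [hℓd]; linarith [hσ.2]
  have hpt : ∀ σ ∈ Ioo y (2 * y), P ≤ A σ + (V t + V t') := by
    intro σ hσ
    have h1 := enorm_sub_sub_smul_le hw (L.symm !₂[h t₁ - m * t₁ + σ, 0]) (L.symm !₂[m, 1]) v htt
    simp only [← graphMap_affine] at h1
    have h2 : ∫⁻ r in Icc t t', ‖fderiv ℝ w (graphMap L ℓ r σ) (L.symm !₂[m, 1]) - v‖ₑ ≤ A σ :=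
      lintegral_mono_set fun r hr => ⟨ht.1.trans_le hr.1, hr.2.trans_lt ht'.2⟩
    have h3 : w (graphMap L h t' 0) - w (graphMap L h t 0) - (t' - t) • v =
        (w (graphMap L ℓ t' σ) - w (graphMap L ℓ t σ) - (t' - t) • v) +
        ((w (graphMap L ℓ t σ) - w (graphMap L h t 0)) -
          (w (graphMap L ℓ t' σ) - w (graphMap L h t' 0))) := by abel
    calc P = _ := congrArg (fun x => ‖x‖ₑ) h3
      _ ≤ _ := (enorm_add_le _ _).trans (add_le_add (h1.trans h2) (enorm_sub_le.trans
          (add_le_add (hvert t ht σ hσ) (hvert t' ht' σ hσ))))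
  have hF : Measurable fun q => ‖fderiv ℝ w q (L.symm !₂[m, 1]) - v‖ₑ :=
    ((continuous_fderiv_apply_const hw _).sub continuous_const).measurable.enorm
  have hE : ∫⁻ σ in Ioo y (2 * y), A σ =
      ∫⁻ q in graphSet L ℓ I (Ioo y (2 * y)), ‖fderiv ℝ w q (L.symm !₂[m, 1]) - v‖ₑ := by
    rw [lintegral_graphSet L hℓc measurableSet_Ioo measurableSet_Ioo hF, hA]
    refine lintegral_lintegral_swap (Measurable.aemeasurable ?_)
    exact hF.comp ((continuous_graphMap L hℓc).measurable.comp measurable_swap)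
  have hvol : volume (Ioo y (2 * y)) = ENNReal.ofReal y := by
    rw [Real.volume_Ioo]; congr 1; ring
  have hy0 : ENNReal.ofReal y ≠ 0 := by simpa using hy
  -- Integrating over `σ` turns the line integrals `A σ` into the integral over the cell and
  -- multiplies the other terms by `y`, the length of `(y, 2 y)`.
  have hyP : ENNReal.ofReal y * P ≤
      (∫⁻ σ in Ioo y (2 * y), A σ) + ENNReal.ofReal y * (V t + V t') := by
    have h1 := setLIntegral_mono' (μ := volume) measurableSet_Ioo hpt
    rw [setLIntegral_const, hvol, mul_comm] at h1
    refine h1.trans ?_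
    rw [lintegral_add_right _ measurable_const, setLIntegral_const, hvol]
    rw [mul_comm (V t + V t')]
  have hdiv := mul_le_mul_right hyP (ENNReal.ofReal y)⁻¹
  rw [← mul_assoc, ENNReal.inv_mul_cancel hy0 ENNReal.ofReal_ne_top, one_mul, mul_add,
    ← mul_assoc, ENNReal.inv_mul_cancel hy0 ENNReal.ofReal_ne_top, one_mul, hE] at hdiv
  exact hdiv

end

/-! ### Averaging over the endpoints of a cell -/

theorem mul_le_of_ae_le_add {μ₁ μ₂ : Measure ℝ} {Y : ℝ≥0∞} (h₁ : μ₁ univ = Y) (h₂ : μ₂ univ = Y)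
    (hY0 : Y ≠ 0) (hY : Y ≠ ⊤) {F : ℝ → ℝ≥0∞} (hF₁ : AEMeasurable F μ₁) {c T : ℝ≥0∞}
    (h : ∀ᵐ t ∂μ₁, ∀ᵐ t' ∂μ₂, c ≤ T + (F t + F t')) :
    c * Y ≤ T * Y + (∫⁻ t, F t ∂μ₁ + ∫⁻ t, F t ∂μ₂) := by
  have hin : ∀ᵐ t ∂μ₁, c * Y ≤ F t * Y + (T * Y + ∫⁻ t', F t' ∂μ₂) := by
    filter_upwards [h] with t ht
    have h3 := lintegral_mono_ae ht
    simp only [← add_assoc] at h3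
    rw [lintegral_const, h₂, lintegral_add_left measurable_const, lintegral_const, h₂] at h3
    refine h3.trans_eq ?_
    ring
  have hout := lintegral_mono_ae hin
  rw [lintegral_const, h₁, lintegral_add_right _ measurable_const, lintegral_const, h₁,
    lintegral_mul_const'' _ hF₁, ← add_mul] at hout
  have := (ENNReal.mul_le_mul_iff_left hY0 hY).1 hout
  refine this.trans_eq ?_
  ring

section

variable (L : Plane ≃ₗᵢ[ℝ] Plane)

theorem graphSet_mono (α : ℝ → ℝ) {I I' J J' : Set ℝ} (hI : I ⊆ I') (hJ : J ⊆ J') :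
    graphSet L α I J ⊆ graphSet L α I' J' :=
  fun _ hq => ⟨hI hq.1, hJ hq.2⟩

/-- Averaging the previous path estimate over endpoints in the first and last subintervals of length
`y` turns the vertical line integrals into integrals over columns. Every term is then an `L¹`
quantity, and `γ`, the future trace, replaces `w` on the boundary at the price of an `L¹` error. -/
theorem cell_bound_of_contDiff {w : Plane → Plane} (hw : ContDiff ℝ 1 w) {h : ℝ → ℝ}
    (hh : Continuous h) {t₁ y N m : ℝ} (hy : 0 < y) (hN : 2 ≤ N)
    (hℓ : ∀ t ∈ Icc t₁ (t₁ + N * y), |h t - (h t₁ + m * (t - t₁))| ≤ y / 2) (v : Plane)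
    {c : ℝ≥0∞} {γ : ℝ → Plane}
    (hγ : AEStronglyMeasurable γ (volume.restrict (Ioo t₁ (t₁ + N * y))))
    (hc : ∀ᵐ t ∂volume.restrict (Ioo t₁ (t₁ + y)),
      ∀ᵐ t' ∂volume.restrict (Ioo (t₁ + (N - 1) * y) (t₁ + N * y)),
        c ≤ ‖γ t' - γ t - (t' - t) • v‖ₑ) :
    c * ENNReal.ofReal y ≤
      (∫⁻ q in graphSet L (fun t => h t₁ + m * (t - t₁))
          (Ioo t₁ (t₁ + N * y)) (Ioo y (2 * y)), ‖fderiv ℝ w q (L.symm !₂[m, 1]) - v‖ₑ) +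
        (((∫⁻ q in graphSet L h (Ioo t₁ (t₁ + y)) (Ioo 0 (3 * y)),
            ‖fderiv ℝ w q (L.symm !₂[1, 0])‖ₑ) +
          ∫⁻ t in Ioo t₁ (t₁ + N * y), ‖w (graphMap L h t 0) - γ t‖ₑ) +
        ((∫⁻ q in graphSet L h (Ioo (t₁ + (N - 1) * y) (t₁ + N * y)) (Ioo 0 (3 * y)),
            ‖fderiv ℝ w q (L.symm !₂[1, 0])‖ₑ) +
          ∫⁻ t in Ioo t₁ (t₁ + N * y), ‖w (graphMap L h t 0) - γ t‖ₑ)) := by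
  set I := Ioo t₁ (t₁ + N * y) with hI
  set I₁ := Ioo t₁ (t₁ + y) with hI₁
  set I₂ := Ioo (t₁ + (N - 1) * y) (t₁ + N * y) with hI₂
  have hNy : y + y ≤ N * y := by nlinarith
  have hI₁I : I₁ ⊆ I := Ioo_subset_Ioo_right (by linarith)
  have hI₂I : I₂ ⊆ I := Ioo_subset_Ioo_left (by nlinarith)
  set V : ℝ → ℝ≥0∞ := fun t =>
    ∫⁻ r in Ioo 0 (3 * y), ‖fderiv ℝ w (graphMap L h t r) (L.symm !₂[1, 0])‖ₑ with hV
  set e : ℝ → ℝ≥0∞ := fun t => ‖w (graphMap L h t 0) - γ t‖ₑ with he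
  have hF0 : Measurable fun q => ‖fderiv ℝ w q (L.symm !₂[1, 0])‖ₑ :=
    (continuous_fderiv_apply_const hw _).measurable.enorm
  have hVm : Measurable V :=
    Measurable.lintegral_prod_right (hF0.comp (continuous_graphMap L hh).measurable)
  have hBc : Continuous fun t => graphMap L h t 0 :=
    (continuous_graphMap L hh).comp (continuous_id.prodMk continuous_const)
  have hem : AEMeasurable e (volume.restrict I) :=
    ((hw.continuous.comp hBc).aestronglyMeasurable.sub hγ).enorm
  have hY0 : ENNReal.ofReal y ≠ 0 := by simpa using hy
  have key := mul_le_of_ae_le_add (μ₁ := volume.restrict I₁) (μ₂ := volume.restrict I₂)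
    (Y := ENNReal.ofReal y) (F := fun t => V t + e t) (c := c)
    (T := (ENNReal.ofReal y)⁻¹ * (∫⁻ q in graphSet L (fun t => h t₁ + m * (t - t₁))
          I (Ioo y (2 * y)), ‖fderiv ℝ w q (L.symm !₂[m, 1]) - v‖ₑ))
    (by rw [Measure.restrict_apply_univ, hI₁, Real.volume_Ioo]; congr 1; ring)
    (by rw [Measure.restrict_apply_univ, hI₂, Real.volume_Ioo]; congr 1; ring)
    hY0 ENNReal.ofReal_ne_top
    (hVm.aemeasurable.add (hem.mono_measure (Measure.restrict_mono hI₁I le_rfl))) (by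
      filter_upwards [hc, ae_restrict_mem measurableSet_Ioo] with t ht htI
      filter_upwards [ht, ae_restrict_mem measurableSet_Ioo] with t' ht' htI'
      have h1 := enorm_boundary_sub_le L hw hy hℓ v (hI₁I htI) (hI₂I htI')
        (by nlinarith [htI.2, htI'.1])
      have h2 : γ t' - γ t - (t' - t) • v =
          (w (graphMap L h t' 0) - w (graphMap L h t 0) - (t' - t) • v) +
            ((w (graphMap L h t 0) - γ t) - (w (graphMap L h t' 0) - γ t')) := by abel
      rw [h2] at ht'
      refine ht'.trans ((enorm_add_le _ _).trans ?_)
      refine (add_le_add h1 enorm_sub_le).trans_eq ?_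
      simp only [hV, he]
      ring)
  rw [mul_comm (ENNReal.ofReal y)⁻¹, mul_assoc, ENNReal.inv_mul_cancel hY0 ENNReal.ofReal_ne_top,
    mul_one, lintegral_add_left hVm, lintegral_add_left hVm] at key
  refine key.trans ?_
  rw [lintegral_graphSet L hh measurableSet_Ioo measurableSet_Ioo hF0,
    lintegral_graphSet L hh measurableSet_Ioo measurableSet_Ioo hF0]
  gcongr

/-- Only `L¹` norms of `w` and its gradient occur in the `C¹` estimate, so it survives the limit
that defines the trace. -/
theorem cell_bound_of_tendsto {Ω : Set Plane} {w : ℕ → Plane → Plane}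
    (hw : ∀ n, ContDiff ℝ 1 (w n)) {h : ℝ → ℝ}
    (hh : Continuous h) {t₁ y N m : ℝ} (hy : 0 < y) (hN : 2 ≤ N)
    (hℓ : ∀ t ∈ Icc t₁ (t₁ + N * y), |h t - (h t₁ + m * (t - t₁))| ≤ y / 2) (v : Plane)
    {c : ℝ≥0∞} {γ : ℝ → Plane}
    (hγ : AEStronglyMeasurable γ (volume.restrict (Ioo t₁ (t₁ + N * y))))
    (hc : ∀ᵐ t ∂volume.restrict (Ioo t₁ (t₁ + y)),
      ∀ᵐ t' ∂volume.restrict (Ioo (t₁ + (N - 1) * y) (t₁ + N * y)),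
        c ≤ ‖γ t' - γ t - (t' - t) • v‖ₑ)
    {Ga Gb : Plane → Plane} (hGa : Measurable Ga) (hGb : Measurable Gb)
    (hwγ : Tendsto (fun n => ∫⁻ t in Ioo t₁ (t₁ + N * y), ‖w n (graphMap L h t 0) - γ t‖ₑ)
      atTop (𝓝 0))
    (hwa : Tendsto (fun n => ∫⁻ q in Ω, ‖fderiv ℝ (w n) q (L.symm !₂[1, 0]) - Ga q‖ₑ) atTop (𝓝 0))
    (hwb : Tendsto (fun n => ∫⁻ q in Ω, ‖fderiv ℝ (w n) q (L.symm !₂[m, 1]) - Gb q‖ₑ) atTop (𝓝 0))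
    (hU : graphSet L (fun t => h t₁ + m * (t - t₁)) (Ioo t₁ (t₁ + N * y)) (Ioo y (2 * y)) ⊆ Ω)
    (hC : graphSet L h (Ioo t₁ (t₁ + N * y)) (Ioo 0 (3 * y)) ⊆ Ω) :
    c * ENNReal.ofReal y ≤
      (∫⁻ q in graphSet L (fun t => h t₁ + m * (t - t₁))
          (Ioo t₁ (t₁ + N * y)) (Ioo y (2 * y)), ‖Gb q - v‖ₑ) +
        ((∫⁻ q in graphSet L h (Ioo t₁ (t₁ + y)) (Ioo 0 (3 * y)), ‖Ga q‖ₑ) +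
        (∫⁻ q in graphSet L h (Ioo (t₁ + (N - 1) * y) (t₁ + N * y)) (Ioo 0 (3 * y)),
            ‖Ga q‖ₑ)) := by
  have hNy : y + y ≤ N * y := by nlinarith
  have hC₁ : graphSet L h (Ioo t₁ (t₁ + y)) (Ioo 0 (3 * y)) ⊆ Ω :=
    (graphSet_mono L h (Ioo_subset_Ioo_right (by linarith)) le_rfl).trans hC
  have hC₂ : graphSet L h (Ioo (t₁ + (N - 1) * y) (t₁ + N * y)) (Ioo 0 (3 * y)) ⊆ Ω :=
    (graphSet_mono L h (Ioo_subset_Ioo_left (by nlinarith)) le_rfl).trans hC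
  have hsplit : ∀ (a v : Plane) (H : Plane → Plane) (S : Set Plane) (n : ℕ), S ⊆ Ω →
      Measurable H → ∫⁻ q in S, ‖fderiv ℝ (w n) q a - v‖ₑ ≤
        (∫⁻ q in S, ‖H q - v‖ₑ) + ∫⁻ q in Ω, ‖fderiv ℝ (w n) q a - H q‖ₑ := by
    intro a v H S n hS hH
    calc ∫⁻ q in S, ‖fderiv ℝ (w n) q a - v‖ₑ
        ≤ ∫⁻ q in S, (‖H q - v‖ₑ + ‖fderiv ℝ (w n) q a - H q‖ₑ) := by
          refine lintegral_mono fun q => ?_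
          have : fderiv ℝ (w n) q a - v = (H q - v) + (fderiv ℝ (w n) q a - H q) := by abel
          simp only
          rw [this]
          exact enorm_add_le _ _
      _ = (∫⁻ q in S, ‖H q - v‖ₑ) + ∫⁻ q in S, ‖fderiv ℝ (w n) q a - H q‖ₑ :=
          lintegral_add_left (hH.sub measurable_const).enorm _
      _ ≤ _ := add_le_add le_rfl (lintegral_mono_set hS)
  have hn := fun n => cell_bound_of_contDiff L (hw n) hh hy hN hℓ v hγ hc
  have hn' := fun n => (hn n).trans (add_le_add (hsplit _ v Gb _ n hU hGb) (add_le_add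
    (add_le_add (by simpa using hsplit (L.symm !₂[1, 0]) 0 Ga _ n hC₁ hGa) le_rfl)
    (add_le_add (by simpa using hsplit (L.symm !₂[1, 0]) 0 Ga _ n hC₂ hGa) le_rfl)))
  have := fun c₀ c₁ c₂ : ℝ≥0∞ => ((tendsto_const_nhds (x := c₀)).add hwb).add
    ((((tendsto_const_nhds (x := c₁)).add hwa).add hwγ).add
      (((tendsto_const_nhds (x := c₂)).add hwa).add hwγ))
  simp only [add_zero] at this
  exact ge_of_tendsto' (this _ _ _) hn'

end

/-! ### Convergence of traces and gradients in `L¹` -/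

theorem tendsto_lintegral_enorm_of_eLpNorm_two {α : Type*} [MeasurableSpace α] {μ : Measure α}
    [IsFiniteMeasure μ] {E : Type*} [NormedAddCommGroup E] {f : ℕ → α → E}
    (hf : ∀ n, AEStronglyMeasurable (f n) μ)
    (h : Tendsto (fun n => eLpNorm (f n) 2 μ) atTop (𝓝 0)) :
    Tendsto (fun n => ∫⁻ x, ‖f n x‖ₑ ∂μ) atTop (𝓝 0) := by
  have h1 : ∀ n, ∫⁻ x, ‖f n x‖ₑ ∂μ ≤ eLpNorm (f n) 2 μ *
      μ univ ^ (1 / (1 : ℝ≥0∞).toReal - 1 / (2 : ℝ≥0∞).toReal) := fun n => by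
    rw [← eLpNorm_one_eq_lintegral_enorm]
    exact eLpNorm_le_eLpNorm_mul_rpow_measure_univ (by norm_num) (hf n)
  refine tendsto_of_tendsto_of_tendsto_of_le_of_le tendsto_const_nhds ?_ (fun _ => zero_le) h1
  have := ENNReal.Tendsto.mul_const (b := μ univ ^ (1 / (1 : ℝ≥0∞).toReal -
    1 / (2 : ℝ≥0∞).toReal)) h (Or.inr (by
      refine ENNReal.rpow_ne_top_of_nonneg (by norm_num) (measure_ne_top _ _)))
  simpa using this

theorem enorm_le_sum_enorm_apply (x : Plane) : ‖x‖ₑ ≤ ∑ i, ‖x i‖ₑ := by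
  have hx : x = ∑ i, EuclideanSpace.single i (x i) := by
    ext i; fin_cases i <;> simp
  conv_lhs => rw [hx]
  refine (enorm_sum_le _ _).trans (Finset.sum_le_sum fun i _ => ?_)
  rw [← ofReal_norm, ← ofReal_norm]
  simp

theorem enorm_apply_le (x : Plane) (i : Fin 2) : ‖x i‖ₑ ≤ ‖x‖ₑ := by
  rw [← ofReal_norm, ← ofReal_norm]
  exact ENNReal.ofReal_le_ofReal (PiLp.norm_apply_le x i)

theorem matVec_apply (A : Mat2) (x : Plane) (i : Fin 2) : matVec A x i = ∑ j, A i j * x j := by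
  simp [matVec, Matrix.mulVec, dotProduct]

theorem enorm_matVec_le (A : Mat2) (x : Plane) :
    ‖matVec A x‖ₑ ≤ ∑ i, ∑ j, ‖A i j‖ₑ * ‖x‖ₑ := by
  refine (enorm_le_sum_enorm_apply _).trans (Finset.sum_le_sum fun i _ => ?_)
  rw [matVec_apply]
  refine (enorm_sum_le _ _).trans (Finset.sum_le_sum fun j _ => ?_)
  rw [enorm_mul]
  gcongr
  exact enorm_apply_le x j

theorem fderiv_apply_eq_matVec {w : Plane → Plane} (hw : ContDiff ℝ 1 w) (q a : Plane) :
    fderiv ℝ w q a = matVec (Matrix.of fun i j => partialDeriv j (fun y => w y i) q) a := by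
  ext i
  rw [matVec_apply]
  have h1 : fderiv ℝ (fun y => w y i) q a = fderiv ℝ w q a i := by
    have := ((EuclideanSpace.proj i : Plane →L[ℝ] ℝ).hasFDerivAt.comp q
      (hw.differentiable one_ne_zero q).hasFDerivAt).fderiv
    have h2 : (fun y => w y i) = (EuclideanSpace.proj i : Plane →L[ℝ] ℝ) ∘ w := rfl
    rw [h2, this]
    rfl
  rw [← h1, fderiv_apply_eq_sum_partialDeriv]
  exact Finset.sum_congr rfl fun k _ => mul_comm _ _

theorem matVec_sub_left (A B : Mat2) (x : Plane) : matVec (A - B) x = matVec A x - matVec B x := by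
  simp [matVec]

theorem tendsto_lintegral_fderiv_sub_matVec {Ω : Set Plane} (hΩ : volume Ω ≠ ⊤)
    {w : ℕ → Plane → Plane} (hw : ∀ n, ContDiff ℝ 1 (w n)) {G : Plane → Mat2}
    (hG : ∀ i j, AEStronglyMeasurable (fun x => G x i j) (volume.restrict Ω))
    (h : ∀ i j, Tendsto
      (fun n => eLpNorm (fun x => partialDeriv j (fun y => w n y i) x - G x i j) 2
        (volume.restrict Ω)) atTop (𝓝 0)) (a : Plane) :
    Tendsto (fun n => ∫⁻ q in Ω, ‖fderiv ℝ (w n) q a - matVec (G q) a‖ₑ) atTop (𝓝 0) := by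
  have : IsFiniteMeasure (volume.restrict Ω) := ⟨by
    rw [Measure.restrict_apply_univ]; exact hΩ.lt_top⟩
  have hcomp : ∀ n i, ContDiff ℝ 1 (fun y => w n y i) := fun n i =>
    (EuclideanSpace.proj i : Plane →L[ℝ] ℝ).contDiff.comp (hw n)
  have hm : ∀ n i j, AEStronglyMeasurable
      (fun x => partialDeriv j (fun y => w n y i) x - G x i j) (volume.restrict Ω) := fun n i j =>
    (continuous_partialDeriv (hcomp n i) j).aestronglyMeasurable.sub (hG i j)
  have h1 := fun i j => tendsto_lintegral_enorm_of_eLpNorm_two (fun n => hm n i j) (h i j)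
  have h2 : Tendsto (fun n => ∑ i, ∑ j,
      (∫⁻ x in Ω, ‖partialDeriv j (fun y => w n y i) x - G x i j‖ₑ) * ‖a‖ₑ) atTop (𝓝 0) := by
    have := tendsto_finsetSum (Finset.univ : Finset (Fin 2)) fun i _ =>
      tendsto_finsetSum (Finset.univ : Finset (Fin 2)) fun j _ =>
        ENNReal.Tendsto.mul_const (b := ‖a‖ₑ) (h1 i j) (Or.inr enorm_ne_top)
    simpa using this
  refine tendsto_of_tendsto_of_tendsto_of_le_of_le tendsto_const_nhds h2 (fun _ => zero_le)
    fun n => ?_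
  calc ∫⁻ q in Ω, ‖fderiv ℝ (w n) q a - matVec (G q) a‖ₑ
      ≤ ∫⁻ q in Ω, ∑ i, ∑ j, ‖partialDeriv j (fun y => w n y i) q - G q i j‖ₑ * ‖a‖ₑ := by
        refine lintegral_mono fun q => ?_
        simp only
        rw [fderiv_apply_eq_matVec (hw n), ← matVec_sub_left]
        exact enorm_matVec_le _ _
    _ = _ := by
        rw [lintegral_finsetSum' _ fun i _ => Finset.aemeasurable_fun_sum _ fun j _ =>
          (hm n i j).enorm.mul_const _]
        refine Finset.sum_congr rfl fun i _ => ?_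
        rw [lintegral_finsetSum' _ fun j _ => (hm n i j).enorm.mul_const _]
        refine Finset.sum_congr rfl fun j _ => ?_
        rw [lintegral_mul_const'' _ (hm n i j).enorm]

section

variable (L : Plane ≃ₗᵢ[ℝ] Plane)

/-- The abscissa is a 1-Lipschitz function of the point, so it does not increase length. This moves
`L²` convergence and almost everywhere bounds from the boundary to the parameter interval. -/
theorem map_graphMap_le_lengthOn {h : ℝ → ℝ} (hh : Continuous h) {I : Set ℝ} {S : Set Plane}
    (hS : ∀ t ∈ I, graphMap L h t 0 ∈ S) :
    (volume.restrict I).map (fun t => graphMap L h t 0) ≤ lengthOn S := by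
  have hBc : Continuous fun t => graphMap L h t 0 :=
    (continuous_graphMap L hh).comp (continuous_id.prodMk continuous_const)
  have hlip : LipschitzWith 1 fun q : Plane => (L q) 1 := by
    refine LipschitzWith.of_dist_le_mul fun x y => ?_
    rw [NNReal.coe_one, one_mul, ← L.dist_map x y, dist_eq_norm, dist_eq_norm]
    exact PiLp.norm_apply_le (L x - L y) 1
  refine Measure.le_iff.2 fun s hs => ?_
  rw [Measure.map_apply hBc.measurable hs, Measure.restrict_apply (hBc.measurable hs), lengthOn,
    Measure.restrict_apply hs, ← hausdorffMeasure_real]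
  have h1 := hlip.hausdorffMeasure_image_le zero_le_one (s ∩ S)
  simp only [ENNReal.coe_one, ENNReal.rpow_one, one_mul] at h1
  refine (measure_mono ?_).trans h1
  rintro t ⟨hts, htI⟩
  exact ⟨graphMap L h t 0, ⟨hts, hS t htI⟩, by simp⟩

theorem tendsto_lintegral_trace {Ω : Set Plane} {h : ℝ → ℝ} (hh : Continuous h) {t₁ t₂ : ℝ}
    (hS : ∀ t ∈ Ioo t₁ t₂, graphMap L h t 0 ∈ frontier Ω) {w : ℕ → Plane → Plane}
    (hw : ∀ n, ContDiff ℝ 1 (w n)) {g : Plane → Plane}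
    (hg : AEStronglyMeasurable g (lengthOn (frontier Ω)))
    (hwg : Tendsto (fun n => eLpNorm (fun x => w n x - g x) 2 (lengthOn (frontier Ω)))
      atTop (𝓝 0)) :
    AEStronglyMeasurable (fun t => g (graphMap L h t 0)) (volume.restrict (Ioo t₁ t₂)) ∧
    Tendsto (fun n => ∫⁻ t in Ioo t₁ t₂, ‖w n (graphMap L h t 0) - g (graphMap L h t 0)‖ₑ)
      atTop (𝓝 0) := by
  have hBc : Continuous fun t => graphMap L h t 0 :=
    (continuous_graphMap L hh).comp (continuous_id.prodMk continuous_const)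
  have hle := map_graphMap_le_lengthOn L hh hS
  have hgm := hg.mono_measure hle
  have hgB : AEStronglyMeasurable (fun t => g (graphMap L h t 0)) (volume.restrict (Ioo t₁ t₂)) :=
    hgm.comp_measurable hBc.measurable
  refine ⟨hgB, ?_⟩
  refine tendsto_lintegral_enorm_of_eLpNorm_two
    (fun n => ((hw n).continuous.comp hBc).aestronglyMeasurable.sub hgB) ?_
  refine tendsto_of_tendsto_of_tendsto_of_le_of_le tendsto_const_nhds hwg (fun _ => zero_le)
    fun n => ?_
  refine le_trans (le_of_eq ?_) (eLpNorm_mono_measure _ hle)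
  exact (eLpNorm_map_measure ((hw n).continuous.aestronglyMeasurable.sub hgm)
    hBc.measurable.aemeasurable).symm

end

/-! ### Distance to the wells -/

section

open scoped Matrix.Norms.Frobenius

/-- The Frobenius distance of a matrix to a set of matrices. -/
noncomputable def wellDist (𝒦 : Set Mat2) (A : Mat2) : ℝ≥0∞ := Metric.infEDist A 𝒦

theorem distSq_eq_wellDist_sq (𝒦 : Set Mat2) (A : Mat2) : distSq A 𝒦 = wellDist 𝒦 A ^ 2 := rfl

theorem abs_apply_le_frobenius_norm (A : Mat2) (i j : Fin 2) : |A i j| ≤ ‖A‖ := by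
  rw [Matrix.frobenius_norm_def, ← Real.sqrt_eq_rpow, ← Real.sqrt_sq_eq_abs]
  refine Real.sqrt_le_sqrt ?_
  have h1 : ∀ i j, 0 ≤ ‖A i j‖ ^ (2 : ℝ) := fun i j => by positivity
  refine le_trans ?_ (Finset.single_le_sum (f := fun i => ∑ j, ‖A i j‖ ^ (2 : ℝ))
    (fun i _ => Finset.sum_nonneg fun j _ => h1 i j) (Finset.mem_univ i))
  refine le_trans ?_ (Finset.single_le_sum (f := fun j => ‖A i j‖ ^ (2 : ℝ))
    (fun j _ => h1 i j) (Finset.mem_univ j))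
  simp

theorem enorm_matVec_sub_le_edist (A K : Mat2) (a : Plane) :
    ‖matVec A a - matVec K a‖ₑ ≤ 4 * edist A K * ‖a‖ₑ := by
  rw [← matVec_sub_left]
  refine (enorm_matVec_le _ _).trans ?_
  have h : ∀ i j, ‖(A - K) i j‖ₑ * ‖a‖ₑ ≤ edist A K * ‖a‖ₑ := fun i j => by
    gcongr
    rw [edist_dist, dist_eq_norm, ← ofReal_norm]
    exact ENNReal.ofReal_le_ofReal (abs_apply_le_frobenius_norm _ i j)
  calc _ ≤ ∑ i : Fin 2, ∑ j : Fin 2, edist A K * ‖a‖ₑ :=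
        Finset.sum_le_sum fun i _ => Finset.sum_le_sum fun j _ => h i j
    _ = _ := by simp only [Fin.sum_univ_two]; ring

/-- A nearest well works for all vectors `a` at once. The factor 4 counts the matrix entries. -/
theorem exists_enorm_matVec_sub_le {𝒦 : Set Mat2} (h𝒦 : IsCompact 𝒦) (hne : 𝒦.Nonempty)
    (A : Mat2) :
    ∃ K ∈ 𝒦, ∀ a, ‖matVec A a - matVec K a‖ₑ ≤ 4 * wellDist 𝒦 A * ‖a‖ₑ := by
  obtain ⟨K, hK, hAK⟩ := IsCompact.exists_infEDist_eq_edist h𝒦 hne A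
  refine ⟨K, hK, fun a => ?_⟩
  unfold wellDist
  rw [hAK]
  exact enorm_matVec_sub_le_edist A K a

theorem exists_enorm_matVec_le {𝒦 : Set Mat2} (h𝒦 : IsCompact 𝒦) :
    ∃ R : ℝ, 0 ≤ R ∧ ∀ K ∈ 𝒦, ∀ a, ‖matVec K a‖ₑ ≤ ENNReal.ofReal R * ‖a‖ₑ := by
  obtain ⟨C, hC⟩ := h𝒦.exists_bound_of_continuousOn (f := fun K : Mat2 => K) continuousOn_id
  refine ⟨4 * max C 0, by positivity, fun K hK a => ?_⟩
  have h := enorm_matVec_sub_le_edist K 0 a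
  rw [← matVec_sub_left, sub_zero] at h
  refine h.trans ?_
  gcongr
  rw [ENNReal.ofReal_mul (by norm_num), edist_dist, dist_zero_right]
  have : ENNReal.ofReal 4 = 4 := by norm_num
  rw [this]
  gcongr
  exact (hC K hK).trans (le_max_left _ _)

end

theorem enorm_matVec_le_wellDist {𝒦 : Set Mat2} (h𝒦 : IsCompact 𝒦) (hne : 𝒦.Nonempty) {R : ℝ}
    (hR : ∀ K ∈ 𝒦, ∀ a, ‖matVec K a‖ₑ ≤ ENNReal.ofReal R * ‖a‖ₑ) (A : Mat2) (a : Plane) :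
    ‖matVec A a‖ₑ ≤ ENNReal.ofReal R * ‖a‖ₑ + 4 * wellDist 𝒦 A * ‖a‖ₑ := by
  obtain ⟨K, hK, h⟩ := exists_enorm_matVec_sub_le h𝒦 hne A
  have : matVec A a = matVec K a + (matVec A a - matVec K a) := by abel
  rw [this]
  exact (enorm_add_le _ _).trans (add_le_add (hR K hK a) (h a))

/-- Pointwise, either `f ≤ η` or `f ≤ f² / η`. This trades the linear distance to the wells for the
quadratic energy, with a small remainder. -/
theorem lintegral_le_add_lintegral_sq {α : Type*} [MeasurableSpace α] (μ : Measure α)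
    (f : α → ℝ≥0∞) {η : ℝ≥0∞} (hη : η ≠ 0) (hη' : η ≠ ⊤) :
    ∫⁻ x, f x ∂μ ≤ η * μ univ + η⁻¹ * ∫⁻ x, f x ^ 2 ∂μ := by
  calc ∫⁻ x, f x ∂μ ≤ ∫⁻ x, (η + η⁻¹ * f x ^ 2) ∂μ := by
        refine lintegral_mono fun x => ?_
        rcases le_total (f x) η with h | h
        · exact h.trans le_self_add
        · refine le_trans ?_ le_add_self
          calc f x = η⁻¹ * (η * f x) := by
                rw [← mul_assoc, ENNReal.inv_mul_cancel hη hη', one_mul]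
            _ ≤ η⁻¹ * (f x * f x) := by gcongr
            _ = _ := by rw [sq]
    _ = _ := by
        rw [lintegral_add_left measurable_const, lintegral_const,
          lintegral_const_mul' _ _ (ENNReal.inv_ne_top.2 hη)]

/-! ### Diameter of a cell and oscillation of the gradient on it -/

section

variable (L : Plane ≃ₗᵢ[ℝ] Plane)

theorem norm_symm_le (x y : ℝ) : ‖L.symm !₂[x, y]‖ ≤ |x| + |y| := by
  rw [L.symm.norm_map, EuclideanSpace.norm_eq]
  simp only [Fin.sum_univ_two, Real.norm_eq_abs]
  refine Real.sqrt_le_iff.2 ⟨by positivity, ?_⟩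
  simp
  nlinarith [abs_nonneg x, abs_nonneg y, sq_abs x, sq_abs y]

theorem norm_sub_le_of_mem_graphSet {α₀ m t₁ N y : ℝ} {p q : Plane}
    (hp : p ∈ graphSet L (fun t => α₀ + m * (t - t₁)) (Ioo t₁ (t₁ + N * y)) (Ioo y (2 * y)))
    (hq : q ∈ graphSet L (fun t => α₀ + m * (t - t₁)) (Ioo t₁ (t₁ + N * y)) (Ioo y (2 * y))) :
    ‖q - p‖ ≤ (N + |m| * N + 1) * y := by
  obtain ⟨⟨hp1, hp2⟩, hp3, hp4⟩ := hp
  obtain ⟨⟨hq1, hq2⟩, hq3, hq4⟩ := hq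
  have h1 : q - p = L.symm !₂[(L q) 0 - (L p) 0, (L q) 1 - (L p) 1] := by
    apply L.injective
    ext i
    fin_cases i <;> simp
  rw [h1]
  refine (norm_symm_le L _ _).trans ?_
  have h2 : |(L q) 1 - (L p) 1| ≤ N * y := abs_le.2 ⟨by linarith, by linarith⟩
  have h3 : |m * ((L q) 1 - (L p) 1)| ≤ |m| * (N * y) := by
    rw [abs_mul]; exact mul_le_mul_of_nonneg_left h2 (abs_nonneg _)
  have h4 : |(L q) 0 - (L p) 0| ≤ |m| * (N * y) + y := by
    rw [abs_le] at h3 ⊢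
    constructor <;> nlinarith
  nlinarith

theorem lintegral_lintegral_enorm_matVec_sub_le {U : Set Plane} (hUo : IsOpen U)
    (hU : Convex ℝ U) {D : ℝ} (hD : ∀ x ∈ U, ∀ y ∈ U, ‖y - x‖ ≤ D) {G : Plane → Mat2}
    (hG : ∀ i j, Integrable (fun x => G x i j)) (hGm : ∀ i j, Measurable (fun x => G x i j))
    (a : Plane) :
    ∫⁻ x in U, ∫⁻ y in U, ∑ i, ∑ j, ‖G y i j - G x i j‖ₑ * ‖a‖ₑ ≤
      4 * ‖a‖ₑ * (volume (Metric.closedBall (0 : Plane) D) *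
        (ENNReal.ofReal D * totalVariation U G)) := by
  have hm : ∀ i j, Measurable fun z : Plane × Plane => ‖G z.2 i j - G z.1 i j‖ₑ := fun i j =>
    (((hGm i j).comp measurable_snd).sub ((hGm i j).comp measurable_fst)).enorm
  have hmx : ∀ i j x, Measurable fun y => ‖G y i j - G x i j‖ₑ := fun i j x =>
    ((hGm i j).sub measurable_const).enorm
  have hint : ∀ i j, Measurable fun x => ∫⁻ y in U, ‖G y i j - G x i j‖ₑ := fun i j =>
    (hm i j).lintegral_prod_right
  have h1 : ∫⁻ x in U, ∫⁻ y in U, ∑ i, ∑ j, ‖G y i j - G x i j‖ₑ * ‖a‖ₑ =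
      ∑ i, ∑ j, (∫⁻ x in U, ∫⁻ y in U, ‖G y i j - G x i j‖ₑ) * ‖a‖ₑ := by
    have h2 : ∀ x, ∫⁻ y in U, ∑ i, ∑ j, ‖G y i j - G x i j‖ₑ * ‖a‖ₑ =
        ∑ i, ∑ j, (∫⁻ y in U, ‖G y i j - G x i j‖ₑ) * ‖a‖ₑ := by
      intro x
      rw [lintegral_finsetSum _ fun i _ => Finset.measurable_fun_sum _ fun j _ =>
        (hmx i j x).mul_const _]
      refine Finset.sum_congr rfl fun i _ => ?_
      rw [lintegral_finsetSum _ fun j _ => (hmx i j x).mul_const _]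
      exact Finset.sum_congr rfl fun j _ => lintegral_mul_const _ (hmx i j x)
    simp only [h2]
    rw [lintegral_finsetSum _ fun i _ => Finset.measurable_fun_sum _ fun j _ =>
      (hint i j).mul_const _]
    refine Finset.sum_congr rfl fun i _ => ?_
    rw [lintegral_finsetSum _ fun j _ => (hint i j).mul_const _]
    exact Finset.sum_congr rfl fun j _ => lintegral_mul_const _ (hint i j)
  rw [h1]
  refine (Finset.sum_le_sum fun i _ => Finset.sum_le_sum fun j _ => mul_le_mul_left
    (lintegral_lintegral_enorm_sub_le hUo hU hD hG hGm i j) _).trans_eq ?_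
  simp only [Fin.sum_univ_two]
  ring

end

/-! ### The energy in a cell -/

section

variable (L : Plane ≃ₗᵢ[ℝ] Plane)

theorem cell_subset_column {h : ℝ → ℝ} {t₁ y N m : ℝ}
    (hℓ : ∀ t ∈ Icc t₁ (t₁ + N * y), |h t - (h t₁ + m * (t - t₁))| ≤ y / 2) :
    graphSet L (fun t => h t₁ + m * (t - t₁)) (Ioo t₁ (t₁ + N * y)) (Ioo y (2 * y)) ⊆
      graphSet L h (Ioo t₁ (t₁ + N * y)) (Ioo (y / 2) (5 / 2 * y)) := by
  rintro q ⟨hq1, hq2, hq3⟩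
  have := abs_le.1 (hℓ _ ⟨hq1.1.le, hq1.2.le⟩)
  exact ⟨hq1, by linarith, by linarith⟩

/-- No single well is good for the whole cell a priori, so for each `x` in the cell the hypothesis
is used with the well nearest to `G x`, and the result is integrated over `x`. Comparing `G q` with
`G x` produces the double integral that the total variation controls. -/
theorem cell_average_bound {𝒦 : Set Mat2} (h𝒦 : IsCompact 𝒦) (hne : 𝒦.Nonempty)
    {R N d m : ℝ} (hR0 : 0 ≤ R) (hR : ∀ K ∈ 𝒦, ∀ a, ‖matVec K a‖ₑ ≤ ENNReal.ofReal R * ‖a‖ₑ)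
    (hd : 0 < d) (hN : 2 ≤ N) (hNR : 24 * R ≤ N * d) {h : ℝ → ℝ} (hh : Continuous h)
    {t₁ y : ℝ} (hy : 0 < y)
    (hℓ : ∀ t ∈ Icc t₁ (t₁ + N * y), |h t - (h t₁ + m * (t - t₁))| ≤ y / 2) {G : Plane → Mat2}
    (hGm : ∀ i j, Measurable (fun x => G x i j))
    (hcell : ∀ K ∈ 𝒦, ENNReal.ofReal (N * d * y / 2) * ENNReal.ofReal y ≤
      (∫⁻ q in graphSet L (fun t => h t₁ + m * (t - t₁))
          (Ioo t₁ (t₁ + N * y)) (Ioo y (2 * y)),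
          ‖matVec (G q) (L.symm !₂[m, 1]) - matVec K (L.symm !₂[m, 1])‖ₑ) +
        ((∫⁻ q in graphSet L h (Ioo t₁ (t₁ + y)) (Ioo 0 (3 * y)),
            ‖matVec (G q) (L.symm !₂[1, 0])‖ₑ) +
        (∫⁻ q in graphSet L h (Ioo (t₁ + (N - 1) * y) (t₁ + N * y)) (Ioo 0 (3 * y)),
            ‖matVec (G q) (L.symm !₂[1, 0])‖ₑ))) :
    ENNReal.ofReal (N * d * y ^ 2 / 4) * ENNReal.ofReal (N * y ^ 2) ≤
      (∫⁻ x in graphSet L (fun t => h t₁ + m * (t - t₁)) (Ioo t₁ (t₁ + N * y)) (Ioo y (2 * y)),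
        ∫⁻ q in graphSet L (fun t => h t₁ + m * (t - t₁)) (Ioo t₁ (t₁ + N * y)) (Ioo y (2 * y)),
          ∑ i, ∑ j, ‖G q i j - G x i j‖ₑ * ‖L.symm !₂[m, 1]‖ₑ) +
      (4 * ‖L.symm !₂[m, 1]‖ₑ + 8) * ENNReal.ofReal (N * y ^ 2) *
        ∫⁻ q in graphSet L h (Ioo t₁ (t₁ + N * y)) (Ioo 0 (3 * y)), wellDist 𝒦 (G q) := by
  have hNy : y + y ≤ N * y := by nlinarith
  set b : Plane := L.symm !₂[m, 1] with hb
  set a₀ : Plane := L.symm !₂[1, 0] with ha₀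
  set ℓ : ℝ → ℝ := fun t => h t₁ + m * (t - t₁) with hℓd
  have hℓc : Continuous ℓ := by fun_prop
  set I := Ioo t₁ (t₁ + N * y) with hI
  set U := graphSet L ℓ I (Ioo y (2 * y)) with hU
  set C := graphSet L h I (Ioo 0 (3 * y)) with hC
  set S := ∫⁻ q in C, wellDist 𝒦 (G q) with hS
  have hUC : U ⊆ C := (cell_subset_column L hℓ).trans
    (graphSet_mono L h le_rfl (Ioo_subset_Ioo (by linarith) (by linarith)))
  have ha₀1 : ‖a₀‖ₑ = 1 := by
    rw [← ofReal_norm, ha₀, L.symm.norm_map, EuclideanSpace.norm_eq]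
    simp
  have hMU : volume U = ENNReal.ofReal (N * y ^ 2) := by
    rw [hU, volume_graphSet L hℓc measurableSet_Ioo measurableSet_Ioo, Real.volume_Ioo,
      Real.volume_Ioo, ← ENNReal.ofReal_mul (by nlinarith)]
    congr 1; ring
  have hcol : ∀ s₁ s₂ : ℝ, s₂ - s₁ = y → Ioo s₁ s₂ ⊆ I →
      ∫⁻ q in graphSet L h (Ioo s₁ s₂) (Ioo 0 (3 * y)), ‖matVec (G q) a₀‖ₑ ≤
        ENNReal.ofReal (3 * R * y ^ 2) + 4 * S := by
    intro s₁ s₂ hs hsI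
    calc _ ≤ ∫⁻ q in graphSet L h (Ioo s₁ s₂) (Ioo 0 (3 * y)),
          (ENNReal.ofReal R + 4 * wellDist 𝒦 (G q)) := by
          refine lintegral_mono fun q => ?_
          simpa [ha₀1] using enorm_matVec_le_wellDist h𝒦 hne hR (G q) a₀
      _ = ENNReal.ofReal R * volume (graphSet L h (Ioo s₁ s₂) (Ioo 0 (3 * y))) +
          4 * ∫⁻ q in graphSet L h (Ioo s₁ s₂) (Ioo 0 (3 * y)), wellDist 𝒦 (G q) := by
          rw [lintegral_add_left measurable_const, setLIntegral_const,
            lintegral_const_mul' _ _ (by norm_num)]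
      _ ≤ _ := by
          refine add_le_add (le_of_eq ?_) (mul_le_mul_right
            (lintegral_mono_set (graphSet_mono L h hsI le_rfl)) _)
          rw [volume_graphSet L hh measurableSet_Ioo measurableSet_Ioo, Real.volume_Ioo,
            Real.volume_Ioo, hs, ← ENNReal.ofReal_mul hy.le, ← ENNReal.ofReal_mul hR0]
          congr 1; ring
  have hK : ∀ K ∈ 𝒦, ENNReal.ofReal (N * d * y ^ 2 / 4) ≤
      (∫⁻ q in U, ‖matVec (G q) b - matVec K b‖ₑ) + 8 * S := by
    intro K hK
    have h1 := (hcell K hK).trans (add_le_add le_rfl (add_le_add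
      (hcol t₁ (t₁ + y) (by ring) (Ioo_subset_Ioo_right (by linarith)))
      (hcol (t₁ + (N - 1) * y) (t₁ + N * y) (by ring) (Ioo_subset_Ioo_left (by nlinarith)))))
    rw [← ENNReal.ofReal_mul (by positivity)] at h1
    have h2 : N * d * y / 2 * y = N * d * y ^ 2 / 4 + N * d * y ^ 2 / 4 := by ring
    -- The two columns, each of area `3 y²`, cost at most half of the lower bound because `24 R ≤ N
    -- d`.
    have h3 : ENNReal.ofReal (3 * R * y ^ 2) + ENNReal.ofReal (3 * R * y ^ 2) ≤
        ENNReal.ofReal (N * d * y ^ 2 / 4) := by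
      rw [← ENNReal.ofReal_add (by positivity) (by positivity)]
      exact ENNReal.ofReal_le_ofReal (by nlinarith [sq_nonneg y])
    rw [h2, ENNReal.ofReal_add (by positivity) (by positivity)] at h1
    have h4 : ENNReal.ofReal (N * d * y ^ 2 / 4) + ENNReal.ofReal (N * d * y ^ 2 / 4) ≤
        ENNReal.ofReal (N * d * y ^ 2 / 4) +
          ((∫⁻ q in U, ‖matVec (G q) b - matVec K b‖ₑ) + 8 * S) := by
      refine h1.trans (le_trans (le_of_eq ?_) (add_le_add h3 le_rfl))
      ring
    exact (ENNReal.add_le_add_iff_left ENNReal.ofReal_ne_top).1 h4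
  have hx : ∀ x, ENNReal.ofReal (N * d * y ^ 2 / 4) ≤
      (∫⁻ q in U, ∑ i, ∑ j, ‖G q i j - G x i j‖ₑ * ‖b‖ₑ) +
        (4 * ‖b‖ₑ * ENNReal.ofReal (N * y ^ 2) * wellDist 𝒦 (G x) + 8 * S) := by
    intro x
    obtain ⟨K, hK𝒦, hxK⟩ := exists_enorm_matVec_sub_le h𝒦 hne (G x)
    refine (hK K hK𝒦).trans ?_
    rw [← add_assoc]
    refine add_le_add ?_ le_rfl
    calc ∫⁻ q in U, ‖matVec (G q) b - matVec K b‖ₑ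
        ≤ ∫⁻ q in U, ((∑ i, ∑ j, ‖G q i j - G x i j‖ₑ * ‖b‖ₑ) +
            4 * wellDist 𝒦 (G x) * ‖b‖ₑ) := by
          refine lintegral_mono fun q => ?_
          have h5 : matVec (G q) b - matVec K b =
              matVec (G q - G x) b + (matVec (G x) b - matVec K b) := by
            rw [matVec_sub_left]; abel
          simp only
          rw [h5]
          exact (enorm_add_le _ _).trans (add_le_add (enorm_matVec_le _ _) (hxK b))
      _ = _ := by
          rw [lintegral_add_right _ measurable_const, setLIntegral_const, hMU]
          ring
  have hm : Measurable fun x => ∫⁻ q in U, ∑ i, ∑ j, ‖G q i j - G x i j‖ₑ * ‖b‖ₑ := by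
    refine Measurable.lintegral_prod_right' (f := fun z : Plane × Plane =>
      ∑ i, ∑ j, ‖G z.2 i j - G z.1 i j‖ₑ * ‖b‖ₑ) ?_
    refine Finset.measurable_fun_sum _ fun i _ => ?_
    refine Finset.measurable_fun_sum _ fun j _ => ?_
    exact (((hGm i j).comp measurable_snd).sub
      ((hGm i j).comp measurable_fst)).enorm.mul_const _
  have hint := lintegral_mono (μ := volume.restrict U) hx
  rw [setLIntegral_const, hMU, lintegral_add_left hm, lintegral_add_right _ measurable_const,
    setLIntegral_const, hMU, lintegral_const_mul' _ _ (ENNReal.mul_ne_top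
      (ENNReal.mul_ne_top (by norm_num) enorm_ne_top) ENNReal.ofReal_ne_top)] at hint
  refine hint.trans (add_le_add le_rfl ?_)
  have hSU : ∫⁻ x in U, wellDist 𝒦 (G x) ≤ S := lintegral_mono_set hUC
  refine (add_le_add (mul_le_mul_right hSU _) le_rfl).trans (le_of_eq ?_)
  ring

/-- The averaged bound scales like `y⁴`; dividing by the area scale `y²` leaves the stated
inequality. The constant does not depend on `t₁`, `y` or `G`, since all cells share the slope `m`.
-/
theorem exists_cell_energy_bound {𝒦 : Set Mat2} (h𝒦 : IsCompact 𝒦) (hne : 𝒦.Nonempty)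
    {R N d : ℝ} (m : ℝ) (hR0 : 0 ≤ R)
    (hR : ∀ K ∈ 𝒦, ∀ a, ‖matVec K a‖ₑ ≤ ENNReal.ofReal R * ‖a‖ₑ)
    (hd : 0 < d) (hN : 2 ≤ N) (hNR : 24 * R ≤ N * d) {h : ℝ → ℝ} (hh : Continuous h) :
    ∃ c : ℝ, 0 < c ∧ ∀ (t₁ y : ℝ), 0 < y →
    (∀ t ∈ Icc t₁ (t₁ + N * y), |h t - (h t₁ + m * (t - t₁))| ≤ y / 2) → ∀ (G : Plane → Mat2),
    (∀ i j, Integrable (fun x => G x i j)) → (∀ i j, Measurable (fun x => G x i j)) →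
    (∀ K ∈ 𝒦, ENNReal.ofReal (N * d * y / 2) * ENNReal.ofReal y ≤
      (∫⁻ q in graphSet L (fun t => h t₁ + m * (t - t₁))
          (Ioo t₁ (t₁ + N * y)) (Ioo y (2 * y)),
          ‖matVec (G q) (L.symm !₂[m, 1]) - matVec K (L.symm !₂[m, 1])‖ₑ) +
        ((∫⁻ q in graphSet L h (Ioo t₁ (t₁ + y)) (Ioo 0 (3 * y)),
            ‖matVec (G q) (L.symm !₂[1, 0])‖ₑ) +
        (∫⁻ q in graphSet L h (Ioo (t₁ + (N - 1) * y) (t₁ + N * y)) (Ioo 0 (3 * y)),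
            ‖matVec (G q) (L.symm !₂[1, 0])‖ₑ))) →
    ENNReal.ofReal (c * y ^ 2) ≤
      ENNReal.ofReal y * totalVariation (graphSet L (fun t => h t₁ + m * (t - t₁))
        (Ioo t₁ (t₁ + N * y)) (Ioo y (2 * y))) G +
      ∫⁻ q in graphSet L h (Ioo t₁ (t₁ + N * y)) (Ioo 0 (3 * y)), distSq (G q) 𝒦 := by
  set B : ℝ := ‖L.symm !₂[m, 1]‖ with hB
  have hB0 : 0 ≤ B := norm_nonneg _
  set D₀ : ℝ := N + |m| * N + 1 with hD₀
  have hD₀pos : 0 < D₀ := by positivity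
  -- Chosen so that the remainder `η · volume C` takes exactly half of the left side `N d / 4`, as
  -- `h6` records.
  set η : ℝ := d / (24 * (4 * B + 8)) with hη
  have hηpos : 0 < η := by positivity
  set a₁ : ℝ := 4 * B * (Real.pi * D₀ ^ 3) with ha₁
  set a₂ : ℝ := (4 * B + 8) * N / η with ha₂
  have ha₁0 : 0 ≤ a₁ := by positivity
  have ha₂0 : 0 < a₂ := by positivity
  refine ⟨N ^ 2 * d / 8 / (a₁ + a₂), by positivity, fun t₁ y hy hℓ G hG hGm hcell => ?_⟩
  set U := graphSet L (fun t => h t₁ + m * (t - t₁)) (Ioo t₁ (t₁ + N * y)) (Ioo y (2 * y)) with hU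
  set C := graphSet L h (Ioo t₁ (t₁ + N * y)) (Ioo 0 (3 * y)) with hC
  rcases eq_or_ne (totalVariation U G) ⊤ with hT | hT
  · rw [hT, ENNReal.mul_top (by simpa using hy), top_add]; exact le_top
  rcases eq_or_ne (∫⁻ q in C, distSq (G q) 𝒦) ⊤ with hE | hE
  · rw [hE, add_top]; exact le_top
  obtain ⟨T, hT0, hTe⟩ : ∃ T : ℝ, 0 ≤ T ∧ totalVariation U G = ENNReal.ofReal T :=
    ⟨_, ENNReal.toReal_nonneg, (ENNReal.ofReal_toReal hT).symm⟩
  obtain ⟨E, hE0, hEe⟩ : ∃ E : ℝ, 0 ≤ E ∧ ∫⁻ q in C, distSq (G q) 𝒦 = ENNReal.ofReal E :=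
    ⟨_, ENNReal.toReal_nonneg, (ENNReal.ofReal_toReal hE).symm⟩
  have h1 := cell_average_bound L h𝒦 hne hR0 hR hd hN hNR hh hy hℓ hGm hcell
  have hℓc : Continuous fun t => h t₁ + m * (t - t₁) := by fun_prop
  have h2 := lintegral_lintegral_enorm_matVec_sub_le (isOpen_graphSet L hℓc isOpen_Ioo isOpen_Ioo)
    (convex_graphSet_affine L (h t₁) m t₁ (convex_Ioo t₁ (t₁ + N * y)) (convex_Ioo y (2 * y)))
    (fun p hp q hq => norm_sub_le_of_mem_graphSet L hp hq) hG hGm (L.symm !₂[m, 1])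
  have h3 := lintegral_le_add_lintegral_sq (volume.restrict C) (fun q => wellDist 𝒦 (G q))
    (η := ENNReal.ofReal η) (by simpa using hηpos) ENNReal.ofReal_ne_top
  simp only [← distSq_eq_wellDist_sq] at h3
  have hVC : volume C = ENNReal.ofReal (3 * N * y ^ 2) := by
    rw [hC, volume_graphSet L hh measurableSet_Ioo measurableSet_Ioo, Real.volume_Ioo,
      Real.volume_Ioo, ← ENNReal.ofReal_mul (by nlinarith)]
    congr 1; ring
  have hball : volume (Metric.closedBall (0 : Plane) (D₀ * y)) =
      ENNReal.ofReal (Real.pi * (D₀ * y) ^ 2) := by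
    rw [EuclideanSpace.volume_closedBall_fin_two, ENNReal.ofReal_mul Real.pi_pos.le, mul_comm,
      ENNReal.ofReal_pow (by positivity)]
  have hBe : ‖L.symm !₂[m, 1]‖ₑ = ENNReal.ofReal B := (ofReal_norm _).symm
  have h4 : (4 : ℝ≥0∞) = ENNReal.ofReal 4 := by norm_num
  have h8 : (8 : ℝ≥0∞) = ENNReal.ofReal 8 := by norm_num
  rw [Measure.restrict_apply_univ, hVC, hEe, ← ENNReal.ofReal_inv_of_pos hηpos,
    ← ENNReal.ofReal_mul hηpos.le, ← ENNReal.ofReal_mul (by positivity),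
    ← ENNReal.ofReal_add (by positivity) (by positivity)] at h3
  rw [← hU, hball, hTe, hBe, h4, ← ENNReal.ofReal_mul (by positivity),
    ← ENNReal.ofReal_mul (by positivity), ← ENNReal.ofReal_mul (by positivity),
    ← ENNReal.ofReal_mul (by positivity)] at h2
  rw [← hBe] at h2
  have h5 := h1.trans (add_le_add h2 (mul_le_mul_right h3 _))
  rw [hBe, h4, h8, ← ENNReal.ofReal_mul (by positivity), ← ENNReal.ofReal_mul (by positivity),
    ← ENNReal.ofReal_add (by positivity) (by positivity), ← ENNReal.ofReal_mul (by positivity),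
    ← ENNReal.ofReal_mul (by positivity), ← ENNReal.ofReal_add (by positivity) (by positivity),
    ENNReal.ofReal_le_ofReal_iff (by positivity)] at h5
  rw [hTe, hEe, ← ENNReal.ofReal_mul hy.le, ← ENNReal.ofReal_add (by positivity) hE0]
  refine ENNReal.ofReal_le_ofReal ?_
  rw [div_mul_eq_mul_div, div_le_iff₀ (by positivity)]
  have h6 : (4 * B + 8) * (η * (3 * N)) = N * d / 8 := by
    rw [hη]; field_simp; ring
  have h7 : N ^ 2 * d / 8 * y ^ 2 ≤ a₁ * (y * T) + a₂ * E := by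
    have h8 : y ^ 2 * (N ^ 2 * d / 8 * y ^ 2) ≤ y ^ 2 * (a₁ * (y * T) + a₂ * E) := by
      have h9 : (4 * B + 8) * (N * y ^ 2) * (η * (3 * N * y ^ 2) + η⁻¹ * E) =
          N * y ^ 4 * ((4 * B + 8) * (η * (3 * N))) + y ^ 2 * (a₂ * E) := by
        rw [ha₂]; field_simp
      rw [h9, h6] at h5
      have h10 : 4 * B * (Real.pi * ((N + |m| * N + 1) * y) ^ 2 * ((N + |m| * N + 1) * y * T)) =
          y ^ 2 * (a₁ * (y * T)) := by
        rw [ha₁, hD₀]; ring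
      linarith [h5, h10]
    exact le_of_mul_le_mul_left h8 (by positivity)
  have h11 : 0 ≤ y * T := by positivity
  nlinarith [mul_nonneg ha₁0 hE0, mul_nonneg ha₂0.le h11]

end

/-! ### The boundary condition on a cell -/

section

variable (L : Plane ≃ₗᵢ[ℝ] Plane)

theorem graphMap_sub_graphMap (h : ℝ → ℝ) (m t t' : ℝ) :
    graphMap L h t' 0 - graphMap L h t 0 - (t' - t) • L.symm !₂[m, 1] =
      (h t' - h t - m * (t' - t)) • L.symm !₂[1, 0] := by
  apply L.injective
  ext i
  fin_cases i
  · simp [graphMap]; ring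
  · simp [graphMap]

theorem norm_symm_unit : ‖L.symm !₂[1, 0]‖ = 1 := by
  rw [L.symm.norm_map, EuclideanSpace.norm_eq]
  simp

theorem one_le_norm_symm (m : ℝ) : 1 ≤ ‖L.symm !₂[m, 1]‖ := by
  rw [L.symm.norm_map]
  have := PiLp.norm_apply_le (!₂[m, 1] : Plane) 1
  simpa using this

theorem lipschitzOnWith_graphMap {h : ℝ → ℝ} {I : Set ℝ} {m : ℝ} {κ : ℝ≥0}
    (hκ : ∀ t ∈ I, ∀ t' ∈ I, |h t' - h t - m * (t' - t)| ≤ κ * |t' - t|) :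
    LipschitzOnWith (‖L.symm !₂[m, 1]‖₊ + κ) (fun t => graphMap L h t 0) I := by
  refine LipschitzOnWith.of_dist_le_mul fun t' ht' t ht => ?_
  rw [dist_eq_norm, dist_eq_norm]
  have h1 : graphMap L h t' 0 - graphMap L h t 0 = (t' - t) • L.symm !₂[m, 1] +
      (h t' - h t - m * (t' - t)) • L.symm !₂[1, 0] := by
    rw [← graphMap_sub_graphMap]; abel
  rw [h1]
  refine (norm_add_le _ _).trans ?_
  rw [norm_smul, norm_smul, norm_symm_unit, mul_one, NNReal.coe_add, coe_nnnorm, add_mul]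
  have := hκ t ht t' ht'
  rw [Real.norm_eq_abs, Real.norm_eq_abs]
  linarith [mul_comm |t' - t| ‖L.symm !₂[m, 1]‖]

/-- Endpoints in the two end subintervals are at least `(N - 2) y ≥ 3 N y / 4` apart, so the
mismatch is at least `(3 / 4) N y d |b|`. The oscillation of the trace and the deviation of the
curve from its tangent direction leave more than half of `N y d`. -/
theorem ae_le_enorm_trace_sub {h : ℝ → ℝ} (hh : Continuous h) {t₁ y N m d : ℝ} {κ : ℝ≥0}
    (hy : 0 < y) (hN : 8 ≤ N) (hd : 0 < d) (hκ1 : (κ : ℝ) ≤ 1) (hκd : (κ : ℝ) ≤ d / 8)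
    (hκ : ∀ t ∈ Ioo t₁ (t₁ + N * y), ∀ t' ∈ Ioo t₁ (t₁ + N * y),
      |h t' - h t - m * (t' - t)| ≤ κ * |t' - t|)
    {g : Plane → Plane}
    (hosc : traceOsc ((fun t => graphMap L h t 0) '' Ioo t₁ (t₁ + N * y)) (fun x => g x - x) ≤
      ENNReal.ofReal (d / 208) *
        Measure.hausdorffMeasure 1 ((fun t => graphMap L h t 0) '' Ioo t₁ (t₁ + N * y)))
    {v : Plane} (hv : d * ‖L.symm !₂[m, 1]‖ ≤ ‖v - L.symm !₂[m, 1]‖) :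
    ∀ᵐ t ∂volume.restrict (Ioo t₁ (t₁ + y)),
      ∀ᵐ t' ∂volume.restrict (Ioo (t₁ + (N - 1) * y) (t₁ + N * y)),
        ENNReal.ofReal (N * d * y / 2) ≤
          ‖g (graphMap L h t' 0) - g (graphMap L h t 0) - (t' - t) • v‖ₑ := by
  set I := Ioo t₁ (t₁ + N * y) with hI
  set B : ℝ → Plane := fun t => graphMap L h t 0 with hB
  set b : Plane := L.symm !₂[m, 1] with hb
  have hNy : 8 * y ≤ N * y := by nlinarith
  have hBc : Continuous B :=
    (continuous_graphMap L hh).comp (continuous_id.prodMk continuous_const)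
  have hH : Measure.hausdorffMeasure 1 (B '' I) ≤ ENNReal.ofReal ((‖b‖ + κ) * (N * y)) := by
    have h1 := (lipschitzOnWith_graphMap L hκ).hausdorffMeasure_image_le zero_le_one
    rw [ENNReal.rpow_one, hausdorffMeasure_real, Real.volume_Ioo] at h1
    refine h1.trans_eq ?_
    rw [ENNReal.ofReal_mul (by positivity), add_sub_cancel_left]
    congr 1
    rw [← coe_nnnorm, ← NNReal.coe_add, ENNReal.ofReal_coe_nnreal]
  have hfin : IsFiniteMeasure (lengthOn (B '' I)) := ⟨by
    rw [lengthOn, Measure.restrict_apply_univ]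
    exact hH.trans_lt ENNReal.ofReal_lt_top⟩
  have hac : (volume.restrict I).map B ≪ lengthOn (B '' I) :=
    (map_graphMap_le_lengthOn L hh fun t ht => mem_image_of_mem B ht).absolutelyContinuous
  -- The essential supremum is with respect to length on the arc, and the image of Lebesgue measure
  -- is absolutely continuous with respect to it.
  have hae : ∀ᵐ z ∂((volume.restrict I).map B).prod ((volume.restrict I).map B),
      ‖(g z.1 - z.1) - (g z.2 - z.2)‖ₑ ≤ ENNReal.ofReal (d / 208 * ((‖b‖ + κ) * (N * y))) := by
    refine (hac.prod hac).ae_le ?_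
    filter_upwards [ENNReal.ae_le_essSup (μ := (lengthOn (B '' I)).prod (lengthOn (B '' I)))
      (fun z : Plane × Plane => ‖(g z.1 - z.1) - (g z.2 - z.2)‖ₑ)] with z hz
    refine hz.trans (hosc.trans ?_)
    rw [ENNReal.ofReal_mul (by positivity)]
    exact mul_le_mul_right hH _
  rw [Measure.map_prod_map _ _ hBc.measurable hBc.measurable] at hae
  have hae2 := Measure.ae_ae_of_ae_prod
    (ae_of_ae_map (hBc.measurable.prodMap hBc.measurable).aemeasurable hae)
  have hI₁ : Ioo t₁ (t₁ + y) ⊆ I := Ioo_subset_Ioo_right (by linarith)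
  have hI₂ : Ioo (t₁ + (N - 1) * y) (t₁ + N * y) ⊆ I := Ioo_subset_Ioo_left (by nlinarith)
  filter_upwards [ae_mono (Measure.restrict_mono hI₁ le_rfl) hae2,
    ae_restrict_mem measurableSet_Ioo] with t ht htI
  filter_upwards [ae_mono (Measure.restrict_mono hI₂ le_rfl) ht,
    ae_restrict_mem measurableSet_Ioo] with t' ht' htI'
  simp only [Prod.map_apply] at ht'
  rw [← ofReal_norm, ENNReal.ofReal_le_ofReal_iff (by positivity)] at ht'
  rw [← ofReal_norm]
  refine ENNReal.ofReal_le_ofReal ?_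
  have hb1 : 1 ≤ ‖b‖ := one_le_norm_symm L m
  have htt : (N - 2) * y ≤ t' - t := by nlinarith [htI.2, htI'.1]
  have htt0 : 0 < t' - t := by nlinarith
  -- The mismatch splits, up to signs, into the quantity to be bounded below, the oscillation of `g
  -- - id`, and the deviation of the arc from direction `b`.
  have h1 : (t' - t) • (v - b) = -(g (B t') - g (B t) - (t' - t) • v) -
      ((g (B t) - B t) - (g (B t') - B t')) + (B t' - B t - (t' - t) • b) := by
    rw [smul_sub]; abel
  have h2 := congrArg norm h1
  rw [norm_smul, Real.norm_of_nonneg htt0.le] at h2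
  have h3 := norm_add_le (-(g (B t') - g (B t) - (t' - t) • v) -
      ((g (B t) - B t) - (g (B t') - B t'))) (B t' - B t - (t' - t) • b)
  have h4 := norm_sub_le (-(g (B t') - g (B t) - (t' - t) • v))
      ((g (B t) - B t) - (g (B t') - B t'))
  rw [norm_neg] at h4
  have h5 : ‖B t' - B t - (t' - t) • b‖ ≤ κ * (t' - t) := by
    rw [hB, hb]
    simp only
    rw [graphMap_sub_graphMap, norm_smul, norm_symm_unit, mul_one, Real.norm_eq_abs]
    refine (hκ t (hI₁ htI) t' (hI₂ htI')).trans_eq ?_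
    rw [abs_of_pos htt0]
  have h6 : (t' - t) * (d * ‖b‖) ≤ (t' - t) * ‖v - b‖ :=
    mul_le_mul_of_nonneg_left hv htt0.le
  have h7 : κ * (t' - t) ≤ d * ‖b‖ / 8 * (t' - t) := by
    refine mul_le_mul_of_nonneg_right (hκd.trans ?_) htt0.le
    nlinarith
  -- Here `κ ≤ 1 ≤ |b|`, so the length of the arc is at most `2 |b| N y`.
  have h8 : d / 208 * ((‖b‖ + κ) * (N * y)) ≤ d * ‖b‖ * (N * y) / 104 := by
    have : (‖b‖ + κ) * (N * y) ≤ (2 * ‖b‖) * (N * y) :=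
      mul_le_mul_of_nonneg_right (by linarith) (by positivity)
    nlinarith
  have h9 : 3 / 4 * (N * y) ≤ t' - t := by nlinarith
  have h10 : d * ‖b‖ * (3 / 4 * (N * y)) ≤ d * ‖b‖ * (t' - t) :=
    mul_le_mul_of_nonneg_left h9 (by positivity)
  have h11 : d * (N * y) ≤ d * ‖b‖ * (N * y) :=
    mul_le_mul_of_nonneg_right (by nlinarith) (by positivity)
  have h12 : 0 ≤ d * (N * y) := by positivity
  change N * d * y / 2 ≤ ‖g (B t') - g (B t) - (t' - t) • v‖
  linarith

/-! ### Local structure of the boundary -/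

theorem mem_frontier_iff_of_epigraph {Ω : Set Plane} (hΩ : IsOpen Ω) {h : ℝ → ℝ}
    (hh : Continuous h) {p : Plane} {ρ : ℝ}
    (hL : ∀ q ∈ Metric.ball p ρ, (q ∈ Ω ↔ h ((L q) 1) < (L q) 0)) {q : Plane}
    (hq : q ∈ Metric.ball p ρ) : q ∈ frontier Ω ↔ (L q) 0 = h ((L q) 1) := by
  have hball : Metric.ball p ρ ∈ 𝓝 q := Metric.isOpen_ball.mem_nhds hq
  have hF : Continuous fun q : Plane => (L q) 0 - h ((L q) 1) := by fun_prop
  rw [hΩ.frontier_eq]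
  constructor
  · rintro ⟨hq1, hq2⟩
    rw [hL q hq, not_lt] at hq2
    refine le_antisymm hq2 ?_
    by_contra hlt
    have h1 : ∀ᶠ r in 𝓝 q, (L r) 0 - h ((L r) 1) < 0 :=
      hF.continuousAt.eventually_lt continuousAt_const (by simpa using hlt)
    obtain ⟨r, ⟨hr1, hr2⟩, hr3⟩ := mem_closure_iff_nhds.1 hq1 _ (Filter.inter_mem h1 hball)
    have := (hL r hr2).1 hr3
    have hr4 : (L r) 0 - h ((L r) 1) < 0 := hr1
    linarith
  · intro heq
    refine ⟨?_, fun hqΩ => absurd ((hL q hq).1 hqΩ) (by rw [heq]; exact lt_irrefl _)⟩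
    have hc : Continuous fun s : ℝ => q + s • L.symm !₂[1, 0] := by fun_prop
    have ht : Tendsto (fun s : ℝ => q + s • L.symm !₂[1, 0]) (𝓝[>] 0) (𝓝 q) := by
      have := (hc.tendsto 0).mono_left (nhdsWithin_le_nhds (s := Ioi 0))
      simpa using this
    refine mem_closure_of_tendsto ht ?_
    filter_upwards [ht hball, eventually_mem_nhdsWithin] with s hs hs0
    rw [hL _ hs]
    have hs0' : (0 : ℝ) < s := hs0
    simp [heq, hs0']

/-- The function `(L q) 0 - h ((L q) 1)` vanishes on `Γ` near `p`, so its derivative kills the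
tangent cone. Thus `τ` is a multiple of `(m, 1)` in the coordinates of `L`, and the mismatch is
homogeneous in the vector. -/
theorem mul_norm_le_norm_matVec_sub {Ω Γ : Set Plane} (hΩ : IsOpen Ω) (hΓ : Γ ⊆ frontier Ω)
    {h : ℝ → ℝ} (hh : ContDiff ℝ 1 h) {p : Plane} (hp : p ∈ Γ) {ρ : ℝ} (hρ : 0 < ρ)
    (hL : ∀ q ∈ Metric.ball p ρ, (q ∈ Ω ↔ h ((L q) 1) < (L q) 0)) {τ : Plane}
    (hτ : τ ∈ tangentConeAt ℝ Γ p) (hτ1 : ‖τ‖ = 1) {d : ℝ} {K : Mat2}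
    (hK : d ≤ ‖matVec K τ - τ‖) :
    d * ‖L.symm !₂[deriv h ((L p) 1), 1]‖ ≤
      ‖matVec K (L.symm !₂[deriv h ((L p) 1), 1]) - L.symm !₂[deriv h ((L p) 1), 1]‖ := by
  set m := deriv h ((L p) 1) with hm
  set F : Plane → ℝ := fun q => (L q) 0 - h ((L q) 1) with hF
  set π : Fin 2 → Plane →L[ℝ] ℝ := fun i =>
    (EuclideanSpace.proj i : Plane →L[ℝ] ℝ).comp (L : Plane →L[ℝ] Plane) with hπ
  have hFd : HasFDerivAt F (π 0 - m • π 1) p := by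
    refine ((π 0).hasFDerivAt).sub ?_
    exact (hh.differentiable one_ne_zero ((L p) 1)).hasDerivAt.comp_hasFDerivAt p
      (π 1).hasFDerivAt
  have hball : Metric.ball p ρ ∈ 𝓝 p := Metric.ball_mem_nhds p hρ
  have hzero : ∀ q ∈ Γ ∩ Metric.ball p ρ, F q = 0 := fun q hq => by
    have := (mem_frontier_iff_of_epigraph L hΩ hh.continuous hL hq.2).1 (hΓ hq.1)
    simp [hF, this]
  rw [← tangentConeAt_inter_nhds hball] at hτ
  have h1 := (hFd.hasFDerivWithinAt (s := Γ ∩ Metric.ball p ρ)).mapsTo_tangent_cone hτ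
  have h2 : (π 0 - m • π 1) τ = 0 := by
    have h3 := tangentConeAt_mono (𝕜 := ℝ) (x := F p) (t := {(0 : ℝ)})
      (image_subset_iff.2 fun q hq => hzero q hq) h1
    have h4 : ¬ AccPt (F p) (𝓟 {(0 : ℝ)}) := by
      rw [accPt_iff_frequently]
      simp [hzero p ⟨hp, mem_of_mem_nhds hball⟩]
    exact tangentConeAt_subset_zero h4 h3
  have h5 : τ = ((L τ) 1) • L.symm !₂[m, 1] := by
    apply L.injective
    ext i
    fin_cases i
    · have : (L τ) 0 - m * (L τ) 1 = 0 := h2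
      simp; linarith
    · simp
  set c := (L τ) 1
  set b := L.symm !₂[m, 1]
  have h6 : |c| * ‖b‖ = 1 := by
    rw [← hτ1]; conv_rhs => rw [h5]
    rw [norm_smul, Real.norm_eq_abs]
  have h7 : ‖matVec K τ - τ‖ = |c| * ‖matVec K b - b‖ := by
    rw [← Real.norm_eq_abs, ← norm_smul]
    conv_lhs => rw [h5]
    congr 1
    rw [smul_sub]
    simp [matVec]
  have hb : 0 ≤ ‖b‖ := norm_nonneg _
  calc d * ‖b‖ ≤ |c| * ‖matVec K b - b‖ * ‖b‖ :=
        mul_le_mul_of_nonneg_right (hK.trans_eq h7) hb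
    _ = (|c| * ‖b‖) * ‖matVec K b - b‖ := by ring
    _ = _ := by rw [h6, one_mul]

/-- Continuity of the chart and of `deriv h` at the base point. The interval starts at the abscissa
of `p`, so that cells are indexed from its left end. -/
theorem exists_local_boundary_chart {Ω Γ : Set Plane} (hΩ : IsOpen Ω)
    (hΓ : IsRelOpen Γ (frontier Ω))
    {h : ℝ → ℝ} (hh : ContDiff ℝ 1 h) {p : Plane} (hp : p ∈ Γ) {ρ : ℝ} (hρ : 0 < ρ)
    (hL : ∀ q ∈ Metric.ball p ρ, (q ∈ Ω ↔ h ((L q) 1) < (L q) 0)) {κ : ℝ} (hκ : 0 < κ) :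
    ∃ δ : ℝ, 0 < δ ∧
      (∀ J ⊆ Icc ((L p) 1) ((L p) 1 + δ), IsOpen J → (fun t => graphMap L h t 0) '' J ⊆ Γ ∧
        IsRelOpen ((fun t => graphMap L h t 0) '' J) Γ) ∧
      graphSet L h (Icc ((L p) 1) ((L p) 1 + δ)) (Ioo 0 (3 * δ)) ⊆ Ω ∧
      ∀ t ∈ Icc ((L p) 1) ((L p) 1 + δ), ∀ t' ∈ Icc ((L p) 1) ((L p) 1 + δ),
        |h t' - h t - deriv h ((L p) 1) * (t' - t)| ≤ κ * |t' - t| := by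
  obtain ⟨V, hV, hΓV⟩ := hΓ
  set t₀ := (L p) 1 with ht₀
  set W := Metric.ball p ρ ∩ V with hW
  have hWo : IsOpen W := Metric.isOpen_ball.inter hV
  have hpf : p ∈ frontier Ω := by rw [hΓV] at hp; exact hp.1
  have hpW : p ∈ W := ⟨Metric.mem_ball_self hρ, by rw [hΓV] at hp; exact hp.2⟩
  have hpg : graphMap L h t₀ 0 = p := by
    have h1 := (mem_frontier_iff_of_epigraph L hΩ hh.continuous hL hpW.1).1 hpf
    have h2 := graphMap_apply L h p
    rwa [h1, sub_self] at h2
  have hev1 : ∀ᶠ z in 𝓝 (t₀, (0 : ℝ)), graphMap L h z.1 z.2 ∈ W := by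
    refine (continuous_graphMap L hh.continuous).continuousAt.eventually_mem ?_
    rw [hpg]; exact hWo.mem_nhds hpW
  have hev2 : ∀ᶠ t in 𝓝 t₀, |deriv h t - deriv h t₀| < κ := by
    have hc : Continuous fun t => |deriv h t - deriv h t₀| :=
      ((hh.continuous_deriv le_rfl).sub continuous_const).abs
    exact hc.continuousAt.eventually_lt continuousAt_const (by simpa using hκ)
  obtain ⟨r₁, hr₁, hW1⟩ := Metric.eventually_nhds_iff.1 hev1
  obtain ⟨r₂, hr₂, hd2⟩ := Metric.eventually_nhds_iff.1 hev2
  set δ := min r₁ r₂ / 4 with hδ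
  have hδ0 : 0 < δ := by positivity
  have hδ1 : 4 * δ ≤ r₁ := by
    have := min_le_left r₁ r₂; linarith
  have hδ2 : 4 * δ ≤ r₂ := by
    have := min_le_right r₁ r₂; linarith
  have hin : ∀ t ∈ Icc t₀ (t₀ + δ), ∀ s, 0 ≤ s → s < 3 * δ → graphMap L h t s ∈ W := by
    intro t ht s hs0 hs
    refine hW1 (y := (t, s)) ?_
    rw [Prod.dist_eq, max_lt_iff, Real.dist_eq, Real.dist_eq, abs_lt, abs_lt]
    exact ⟨⟨by linarith [ht.1], by linarith [ht.2]⟩, by simp only; linarith, by simp only; linarith⟩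
  have hmem : ∀ t ∈ Icc t₀ (t₀ + δ), graphMap L h t 0 ∈ Γ := by
    intro t ht
    have h1 := hin t ht 0 le_rfl (by linarith)
    rw [hΓV]
    exact ⟨(mem_frontier_iff_of_epigraph L hΩ hh.continuous hL h1.1).2 (by simp), h1.2⟩
  refine ⟨δ, hδ0, fun J hJ hJo => ⟨?_, ?_⟩, ?_, ?_⟩
  · rintro _ ⟨t, ht, rfl⟩
    exact hmem t (hJ ht)
  · refine ⟨{q | (L q) 1 ∈ J} ∩ Metric.ball p ρ, IsOpen.inter ?_ Metric.isOpen_ball, ?_⟩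
    · exact hJo.preimage (by fun_prop : Continuous fun q : Plane => (L q) 1)
    · ext q
      constructor
      · rintro ⟨t, ht, rfl⟩
        exact ⟨hmem t (hJ ht), by simpa using ht, (hin t (hJ ht) 0 le_rfl (by linarith)).1⟩
      · rintro ⟨hqΓ, hqJ, hqb⟩
        rw [hΓV] at hqΓ
        have h1 := (mem_frontier_iff_of_epigraph L hΩ hh.continuous hL hqb).1 hqΓ.1
        refine ⟨(L q) 1, hqJ, ?_⟩
        have h2 := graphMap_apply L h q
        rwa [h1, sub_self] at h2
  · rintro q ⟨hq1, hq2⟩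
    have h1 := hin _ hq1 _ hq2.1.le hq2.2
    rw [graphMap_apply] at h1
    rw [hL q h1.1]
    linarith [hq2.1]
  · intro t ht t' ht'
    have hmv := Convex.norm_image_sub_le_of_norm_hasDerivWithin_le
      (f := fun t => h t - deriv h t₀ * t) (f' := fun t => deriv h t - deriv h t₀) (C := κ)
      (fun s hs => ?_) (fun s hs => ?_) (convex_Icc t₀ (t₀ + δ)) ht ht'
    · rw [Real.norm_eq_abs, Real.norm_eq_abs] at hmv
      convert hmv using 2
      ring
    · refine HasDerivAt.hasDerivWithinAt ?_
      have h1 := (hh.differentiable one_ne_zero s).hasDerivAt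
      have h2 : HasDerivAt (fun t => deriv h t₀ * t) (deriv h t₀) s := by
        simpa using (hasDerivAt_id s).const_mul (deriv h t₀)
      exact h1.sub h2
    · rw [Real.norm_eq_abs]
      refine (hd2 ?_).le
      rw [Real.dist_eq, abs_lt]
      constructor <;> linarith [hs.1, hs.2]

end

/-! ### Summation over dyadic scales -/

/-- Extension by zero outside `Ω` makes the gradient measurable and integrable on the whole plane,
as the translation and Fubini arguments require; the energy sees only values almost everywhere in
`Ω`. -/
theorem exists_measurable_representative {Ω : Set Plane} (hΩo : IsOpen Ω)
    (hΩ : Bornology.IsBounded Ω) {G : Plane → Mat2}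
    (hG : ∀ i j, MemLp (fun x => G x i j) 2 (volume.restrict Ω)) :
    ∃ H : Plane → Mat2, (∀ i j, Measurable (fun x => H x i j)) ∧
      (∀ i j, Integrable (fun x => H x i j)) ∧ ∀ᵐ x ∂volume.restrict Ω, G x = H x := by
  have : IsFiniteMeasure (volume.restrict Ω) := ⟨by
    rw [Measure.restrict_apply_univ]; exact hΩ.measure_lt_top⟩
  set F : Fin 2 → Fin 2 → Plane → ℝ := fun i j => (hG i j).1.mk _ with hF
  have hFm : ∀ i j, Measurable (F i j) := fun i j =>
    (hG i j).1.stronglyMeasurable_mk.measurable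
  refine ⟨fun x => Matrix.of fun i j => Ω.indicator (F i j) x, fun i j => ?_, fun i j => ?_, ?_⟩
  · exact (hFm i j).indicator hΩo.measurableSet
  · have h1 : Integrable (F i j) (volume.restrict Ω) :=
      ((hG i j).integrable one_le_two).congr (hG i j).1.ae_eq_mk
    exact (integrable_indicator_iff hΩo.measurableSet).2 h1
  · have h1 : ∀ᵐ x ∂volume.restrict Ω, ∀ i j, G x i j = F i j x :=
      ae_all_iff.2 fun i => ae_all_iff.2 fun j => (hG i j).1.ae_eq_mk
    filter_upwards [h1, ae_restrict_mem hΩo.measurableSet] with x hx hxΩ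
    ext i j
    simp [hxΩ, hx]

/-- A ratio above 5 between consecutive scales separates the heights `(y / 2, 5 y / 2)`; the ratio
used is 8. Within one scale the abscissas are disjoint. -/
theorem pairwiseDisjoint_scales (L : Plane ≃ₗᵢ[ℝ] Plane) (h : ℝ → ℝ) (t₀ : ℝ) {N y₀ : ℝ}
    (hN : 0 < N) (hy₀ : 0 < y₀) (S : Set (Σ _ : ℕ, ℕ)) :
    S.PairwiseDisjoint fun a => graphSet L h
      (Ioo (t₀ + a.2 * (N * (y₀ / 8 ^ a.1))) (t₀ + a.2 * (N * (y₀ / 8 ^ a.1)) + N * (y₀ / 8 ^ a.1)))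
      (Ioo (y₀ / 8 ^ a.1 / 2) (5 / 2 * (y₀ / 8 ^ a.1))) := by
  have hheight : ∀ k k' : ℕ, k < k' → 8 * (y₀ / 8 ^ k') ≤ y₀ / 8 ^ k := by
    intro k k' hk
    have h1 : (8 : ℝ) ^ (k + 1) ≤ 8 ^ k' := pow_le_pow_right₀ (by norm_num) hk
    rw [← mul_div_assoc, div_le_div_iff₀ (by positivity) (by positivity)]
    rw [pow_succ] at h1
    nlinarith
  have hpos : ∀ k : ℕ, 0 < y₀ / 8 ^ k := fun k => by positivity
  rintro ⟨k, j⟩ - ⟨k', j'⟩ - hne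
  refine disjoint_left.2 ?_
  rintro q ⟨hq1, hq2⟩ ⟨hq1', hq2'⟩
  simp only at hq1 hq2 hq1' hq2'
  rcases lt_trichotomy k k' with hk | rfl | hk
  · have := hheight k k' hk
    have := hpos k'
    linarith [hq2.1, hq2'.2]
  · have hz : 0 < N * (y₀ / 8 ^ k) := mul_pos hN (hpos k)
    have h1 : ∀ a b : ℕ, a < b → (a : ℝ) * (N * (y₀ / 8 ^ k)) + N * (y₀ / 8 ^ k) ≤
        b * (N * (y₀ / 8 ^ k)) := by
      intro a b hab
      have : ((a : ℝ) + 1) ≤ b := by exact_mod_cast hab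
      nlinarith
    rcases lt_trichotomy j j' with hj | rfl | hj
    · linarith [h1 j j' hj, hq1.2, hq1'.1]
    · exact hne rfl
    · linarith [h1 j' j hj, hq1.1, hq1'.2]
  · have := hheight k' k hk
    have := hpos k
    linarith [hq2.2, hq2'.1]

/-- Summing a lower bound on cells of sizes `y₀ / 8 ^ k`. -/
theorem sum_cells_le (L : Plane ≃ₗᵢ[ℝ] Plane) {h : ℝ → ℝ} (hh : Continuous h) {t₀ N y₀ m c : ℝ}
    (hN : 0 < N) (hy₀ : 0 < y₀) (hc : 0 < c) {Ω : Set Plane} {G : Plane → Mat2}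
    (hG : ∀ i j, Integrable (fun x => G x i j)) {f : Plane → ℝ≥0∞}
    (hΩ : graphSet L h (Ico t₀ (t₀ + N * y₀)) (Ioo 0 (3 * y₀)) ⊆ Ω)
    (hcell : ∀ t₁ y, 0 < y → y ≤ y₀ → t₀ ≤ t₁ → t₁ + N * y ≤ t₀ + N * y₀ →
      graphSet L (fun t => h t₁ + m * (t - t₁)) (Ioo t₁ (t₁ + N * y)) (Ioo y (2 * y)) ⊆
        graphSet L h (Ioo t₁ (t₁ + N * y)) (Ioo (y / 2) (5 / 2 * y)) ∧
      ENNReal.ofReal (c * y ^ 2) ≤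
        ENNReal.ofReal y * totalVariation (graphSet L (fun t => h t₁ + m * (t - t₁))
          (Ioo t₁ (t₁ + N * y)) (Ioo y (2 * y))) G +
        ∫⁻ q in graphSet L h (Ioo t₁ (t₁ + N * y)) (Ioo 0 (3 * y)), f q) (n : ℕ) :
    ENNReal.ofReal (n * (c * y₀)) ≤
      totalVariation Ω G + ENNReal.ofReal (8 ^ n / y₀) * ∫⁻ q in Ω, f q := by
  set z : ℕ → ℝ := fun k => y₀ / 8 ^ k with hz
  have hzpos : ∀ k, 0 < z k := fun k => by positivity
  have hzle : ∀ k, z k ≤ y₀ := fun k =>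
    div_le_self hy₀.le (one_le_pow₀ (by norm_num))
  set s : ℕ → ℕ → ℝ := fun k j => t₀ + j * (N * z k) with hs
  have hs0 : ∀ k j, t₀ ≤ s k j := fun k j => by
    have := hzpos k
    simp only [hs]; nlinarith [mul_nonneg (Nat.cast_nonneg (α := ℝ) j) (mul_pos hN this).le]
  have hs1 : ∀ k, ∀ j ∈ Finset.range (8 ^ k), s k j + N * z k ≤ t₀ + N * y₀ := by
    intro k j hj
    have hj' : ((j : ℝ) + 1) ≤ 8 ^ k := by exact_mod_cast Finset.mem_range.1 hj
    have h1 : (8 : ℝ) ^ k * (N * z k) = N * y₀ := by simp only [hz]; field_simp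
    simp only [hs]
    nlinarith [mul_pos hN (hzpos k)]
  set U : (Σ _ : ℕ, ℕ) → Set Plane := fun a =>
    graphSet L (fun t => h (s a.1 a.2) + m * (t - s a.1 a.2))
      (Ioo (s a.1 a.2) (s a.1 a.2 + N * z a.1)) (Ioo (z a.1) (2 * z a.1)) with hU
  set A : Finset (Σ _ : ℕ, ℕ) := (Finset.range n).sigma fun k => Finset.range (8 ^ k) with hA
  have hUsub : ∀ a ∈ A, U a ⊆ graphSet L h (Ioo (s a.1 a.2) (s a.1 a.2 + N * z a.1))
      (Ioo (z a.1 / 2) (5 / 2 * z a.1)) := fun a ha =>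
    (hcell _ _ (hzpos _) (hzle _) (hs0 _ _) (hs1 _ _ (Finset.mem_sigma.1 ha).2)).1
  have hstrip : ∀ k, ∀ j ∈ Finset.range (8 ^ k), ∀ J ⊆ Ioo 0 (3 * z k),
      graphSet L h (Ioo (s k j) (s k j + N * z k)) J ⊆ Ω := fun k j hj J hJ =>
    (graphSet_mono L h (Ioo_subset_Ico_self.trans (Ico_subset_Ico (hs0 k j) (hs1 k j hj)))
      (hJ.trans (Ioo_subset_Ioo_right (by linarith [hzle k])))).trans hΩ
  have hdisj := pairwiseDisjoint_scales L h t₀ hN hy₀ (A : Set (Σ _ : ℕ, ℕ))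
  have hUdisj : (A : Set (Σ _ : ℕ, ℕ)).PairwiseDisjoint U := fun a ha b hb hab =>
    (hdisj ha hb hab).mono (hUsub a ha) (hUsub b hb)
  have hTV : ∑ k ∈ Finset.range n, ∑ j ∈ Finset.range (8 ^ k), totalVariation (U ⟨k, j⟩) G ≤
      totalVariation Ω G := by
    rw [← Finset.sum_sigma (Finset.range n) (fun k => Finset.range (8 ^ k))
      (fun a => totalVariation (U a) G)]
    refine (sum_totalVariation_le hG A U hUdisj).trans (totalVariation_mono ?_ G)
    refine iUnion₂_subset fun a ha => (hUsub a ha).trans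
      (hstrip _ _ (Finset.mem_sigma.1 ha).2 _ ?_)
    have := hzpos a.1
    exact Ioo_subset_Ioo (by linarith) (by linarith)
  -- The columns are disjoint only within a scale, so each scale is charged the full elastic energy.
  have hEL : ∀ k, ∑ j ∈ Finset.range (8 ^ k), ∫⁻ q in graphSet L h
      (Ioo (s k j) (s k j + N * z k)) (Ioo 0 (3 * z k)), f q ≤ ∫⁻ q in Ω, f q := by
    intro k
    rw [← lintegral_biUnion_finset]
    · exact lintegral_mono_set (iUnion₂_subset fun j hj => hstrip k j hj _ le_rfl)
    · intro i _ j _ hij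
      have hz' : 0 < N * z k := mul_pos hN (hzpos k)
      have h1 : ∀ a b : ℕ, a < b → s k a + N * z k ≤ s k b := by
        intro a b hab
        have : ((a : ℝ) + 1) ≤ b := by exact_mod_cast hab
        simp only [hs]; nlinarith
      refine disjoint_left.2 ?_
      rintro q ⟨hq, -⟩ ⟨hq', -⟩
      rcases lt_or_gt_of_ne hij with hlt | hlt
      · linarith [h1 i j hlt, hq.2, hq'.1]
      · linarith [h1 j i hlt, hq.1, hq'.2]
    · exact fun j _ => measurableSet_graphSet L hh measurableSet_Ioo measurableSet_Ioo
  have hscale : ∀ k, ENNReal.ofReal (c * y₀) ≤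
      ∑ j ∈ Finset.range (8 ^ k), totalVariation (U ⟨k, j⟩) G +
        ENNReal.ofReal (8 ^ k / y₀) * ∫⁻ q in Ω, f q := by
    intro k
    have h1 : ∑ j ∈ Finset.range (8 ^ k), ENNReal.ofReal (c * z k ^ 2) ≤
        ENNReal.ofReal (z k) * ∑ j ∈ Finset.range (8 ^ k), totalVariation (U ⟨k, j⟩) G +
          ∫⁻ q in Ω, f q := by
      refine le_trans (Finset.sum_le_sum fun j hj =>
        (hcell _ _ (hzpos k) (hzle k) (hs0 k j) (hs1 k j hj)).2) ?_
      rw [Finset.sum_add_distrib, ← Finset.mul_sum]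
      exact add_le_add le_rfl (hEL k)
    rw [Finset.sum_const, Finset.card_range, nsmul_eq_mul] at h1
    have h2 : ((8 ^ k : ℕ) : ℝ≥0∞) = ENNReal.ofReal (8 ^ k) := by
      rw [← ENNReal.ofReal_natCast]; push_cast; rfl
    rw [h2, ← ENNReal.ofReal_mul (by positivity)] at h1
    have h3 := mul_le_mul_right h1 (ENNReal.ofReal (8 ^ k / y₀))
    have h4 : 8 ^ k / y₀ * z k = 1 := by simp only [hz]; field_simp
    have h5 : 8 ^ k / y₀ * (8 ^ k * (c * z k ^ 2)) = c * y₀ := by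
      simp only [hz]; field_simp
    rwa [← ENNReal.ofReal_mul (by positivity), h5, mul_add, ← mul_assoc,
      ← ENNReal.ofReal_mul (by positivity), h4, ENNReal.ofReal_one, one_mul] at h3
  have hsum := Finset.sum_le_sum fun k (_ : k ∈ Finset.range n) => hscale k
  rw [Finset.sum_const, Finset.card_range, nsmul_eq_mul, Finset.sum_add_distrib,
    ← Finset.sum_mul] at hsum
  -- The repeated elastic energy costs no factor `n`, because the weights form a geometric sum.
  have hgeom : ∑ k ∈ Finset.range n, ENNReal.ofReal (8 ^ k / y₀) ≤ ENNReal.ofReal (8 ^ n / y₀) := by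
    rw [← ENNReal.ofReal_sum_of_nonneg fun k _ => by positivity]
    refine ENNReal.ofReal_le_ofReal ?_
    rw [← Finset.sum_div]
    refine div_le_div_of_nonneg_right ?_ hy₀.le
    rw [geom_sum_eq (by norm_num)]
    have : (1 : ℝ) ≤ 8 ^ n := one_le_pow₀ (by norm_num)
    rw [div_le_iff₀ (by norm_num)]
    linarith
  rw [ENNReal.ofReal_mul (by positivity), ENNReal.ofReal_natCast]
  exact hsum.trans (add_le_add hTV (mul_le_mul_left hgeom _))

/-! ### From the number of scales to the logarithm -/

theorem exists_nat_scale {ε : ℝ} (hε : 0 < ε) (hε1 : ε ≤ 1) :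
    ∃ n : ℕ, (8 : ℝ) ^ n * ε ≤ 8 ∧ |Real.log ε| + 1 ≤ 4 * n := by
  obtain ⟨n, hn1, hn2⟩ := exists_nat_pow_near (one_le_one_div hε hε1) (by norm_num : (1 : ℝ) < 8)
  -- One scale beyond the last `n` with `8 ^ n ≤ 1 / ε`: there is then at least one scale, which
  -- absorbs the summand 1 in `|log ε| + 1`.
  refine ⟨n + 1, ?_, ?_⟩
  · rw [le_div_iff₀ hε] at hn1
    rw [pow_succ]; linarith
  · have h1 := Real.log_lt_log (by positivity) hn2
    have h8 : Real.log 8 = 3 * Real.log 2 := by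
      rw [show (8 : ℝ) = 2 ^ 3 by norm_num, Real.log_pow]; norm_num
    rw [Real.log_pow, one_div, Real.log_inv, h8] at h1
    rw [abs_of_nonpos (Real.log_nonpos hε.le hε1)]
    have h2 := Real.log_two_lt_d9
    push_cast at h1 ⊢
    nlinarith [Nat.cast_nonneg (α := ℝ) n]

/-- A bound linear in the number of scales gives the logarithmic lower bound. -/
theorem exists_log_lower_bound {c₀ y₀ : ℝ} (hc₀ : 0 < c₀) (hy₀ : 0 < y₀) :
    ∃ c : ℝ, 0 < c ∧ ∀ ε : ℝ, 0 < ε → ∀ T E : ℝ≥0∞,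
      (∀ n : ℕ, ENNReal.ofReal (n * c₀) ≤ T + ENNReal.ofReal (8 ^ n / y₀) * E) →
      ENNReal.ofReal (c * min 1 (ε * (|Real.log ε| + 1))) ≤ E + ENNReal.ofReal ε * T := by
  set M : ℝ := max 1 (8 / y₀) with hM
  have hM1 : 1 ≤ M := le_max_left _ _
  have hM2 : 8 / y₀ ≤ M := le_max_right _ _
  have hM0 : 0 < M := by linarith
  refine ⟨c₀ / (4 * M), by positivity, fun ε hε T E h => ?_⟩
  have hmain : ∀ a : ℝ, 0 ≤ a → ENNReal.ofReal a ≤ ENNReal.ofReal M * (E + ENNReal.ofReal ε * T) →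
      c₀ / (4 * M) * min 1 (ε * (|Real.log ε| + 1)) ≤ a / M →
      ENNReal.ofReal (c₀ / (4 * M) * min 1 (ε * (|Real.log ε| + 1))) ≤
        E + ENNReal.ofReal ε * T := by
    intro a ha h1 h2
    refine (ENNReal.ofReal_le_ofReal h2).trans ?_
    rw [ENNReal.ofReal_div_of_pos hM0]
    exact ENNReal.div_le_of_le_mul' h1
  have hM1' : (1 : ℝ≥0∞) ≤ ENNReal.ofReal M := by
    rw [← ENNReal.ofReal_one]; exact ENNReal.ofReal_le_ofReal hM1
  rcases le_total ε 1 with hε1 | hε1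
  · obtain ⟨n, hn1, hn2⟩ := exists_nat_scale hε hε1
    refine hmain (ε * (n * c₀)) (by positivity) ?_ ?_
    · rw [ENNReal.ofReal_mul hε.le]
      refine (mul_le_mul_right (h n) _).trans ?_
      rw [mul_add, ← mul_assoc, ← ENNReal.ofReal_mul hε.le, mul_add, add_comm]
      refine add_le_add (mul_le_mul_left (ENNReal.ofReal_le_ofReal ?_) _)
        (le_mul_of_one_le_left' hM1')
      refine le_trans ?_ hM2
      rw [← mul_div_assoc]
      exact div_le_div_of_nonneg_right (by linarith) hy₀.le
    · have h1 : min 1 (ε * (|Real.log ε| + 1)) ≤ ε * (4 * n) :=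
        (min_le_right _ _).trans (mul_le_mul_of_nonneg_left hn2 hε.le)
      calc _ ≤ c₀ / (4 * M) * (ε * (4 * n)) := mul_le_mul_of_nonneg_left h1 (by positivity)
        _ = _ := by field_simp
  -- For `ε ≥ 1` the minimum is at most 1, and a single scale suffices.
  · refine hmain c₀ hc₀.le ?_ ?_
    · have h1 := h 1
      rw [Nat.cast_one, one_mul, pow_one] at h1
      refine h1.trans ?_
      rw [mul_add, add_comm]
      refine add_le_add (mul_le_mul_left (ENNReal.ofReal_le_ofReal hM2) _) ?_
      have hε1' : (1 : ℝ≥0∞) ≤ ENNReal.ofReal ε := by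
        rw [← ENNReal.ofReal_one]; exact ENNReal.ofReal_le_ofReal hε1
      exact (le_mul_of_one_le_left' hε1').trans (le_mul_of_one_le_left' hM1')
    · calc _ ≤ c₀ / (4 * M) * 1 := mul_le_mul_of_nonneg_left (min_le_left _ _) (by positivity)
        _ ≤ _ := by
          rw [mul_one]
          exact div_le_div_of_nonneg_left hc₀.le hM0 (by linarith)

/-! ### The lower bound for the energy -/

theorem measurable_matVec {H : Plane → Mat2} (hH : ∀ i j, Measurable (fun x => H x i j))
    (a : Plane) : Measurable fun q => matVec (H q) a := by
  have h1 : (fun q => matVec (H q) a) =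
      fun q => ∑ i, (∑ j, H q i j * a j) • EuclideanSpace.single i (1 : ℝ) := by
    funext q
    ext i
    rw [matVec_apply]
    fin_cases i <;> simp
  rw [h1]
  refine Finset.measurable_fun_sum _ fun i _ => ?_
  exact (Finset.measurable_fun_sum _ fun j _ => (hH i j).mul_const _).smul_const _

theorem mainTheorem1
    (𝒦 : Set Mat2) (h𝒦 : IsCompact 𝒦)
    (Ω : Set Plane) (hΩ : IsBoundedLipschitzDomain Ω)
    (Γ : Set Plane) (hΓ : IsC3BoundaryPortion Ω Γ)
    (τ : Plane → Plane) (hτ : IsC2UnitTangentField Γ τ)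
    (d : ℝ) (hd : IsLeast (tangentialMismatch 𝒦 Γ τ) d) (hd_pos : 0 < d) :
    ∃ c : ℝ, 0 < c ∧
      ∀ ε : ℝ, 0 < ε →
      ∀ (u : Plane → Plane) (G : Plane → Mat2) (g : Plane → Plane),
        IsSobolevW12 Ω u G → IsTrace Ω u G g →
        (∀ Γ' : Set Plane, Γ' ⊆ Γ → IsRelOpen Γ' Γ → IsConnected Γ' →
          traceOsc Γ' (fun x => g x - x) ≤
            ENNReal.ofReal (d / 208) * Measure.hausdorffMeasure 1 Γ') →
        ENNReal.ofReal (c * min 1 (ε * (|Real.log ε| + 1))) ≤ energy 𝒦 Ω ε G := by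
  -- The minimum `d` is attained, so neither `𝒦` nor `Γ` is empty.
  obtain ⟨⟨x₀, e₀, hxe, K₀, hK₀, -⟩, hd_le⟩ := hd
  have hne : 𝒦.Nonempty := ⟨K₀, hK₀⟩
  obtain ⟨⟨p, _⟩, hp, -⟩ := closure_nonempty_iff.1 ⟨_, hxe⟩
  have hp : p ∈ Γ := hp
  have hΓf : Γ ⊆ frontier Ω := by
    obtain ⟨V, -, hV⟩ := hΓ.isRelOpen
    rw [hV]; exact inter_subset_left
  obtain ⟨h, hh3, L, ρ, hρ, hL⟩ := hΓ.regular p hp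
  have hh : ContDiff ℝ 1 h := hh3.of_le (by norm_num)
  set m := deriv h ((L p) 1) with hm
  set b := L.symm !₂[m, 1] with hb
  have hmis : ∀ K ∈ 𝒦, d * ‖b‖ ≤ ‖matVec K b - b‖ := fun K hK =>
    mul_norm_le_norm_matVec_sub L hΩ.isOpen hΓf hh hp hρ hL (hτ.tangent p hp)
      (hτ.norm_eq_one p hp) (hd_le ⟨p, τ p, subset_closure ⟨hp, rfl⟩, K, hK, rfl⟩)
  obtain ⟨R, hR0, hR⟩ := exists_enorm_matVec_le h𝒦
  -- Long enough for the end subintervals to be short relative to the cell and for the vertical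
  -- paths to be absorbed.
  set N : ℝ := 8 + 24 * R / d with hN
  have hN8 : 8 ≤ N := by
    have : 0 ≤ 24 * R / d := by positivity
    linarith
  have hNR : 24 * R ≤ N * d := by
    have : 24 * R / d * d = 24 * R := by field_simp
    rw [hN]; nlinarith
  -- The bounds 1 and `d / 8` serve the trace estimate; `1 / (2 N)` keeps the graph within `y / 2`
  -- of its line over a cell of length `N y`.
  have hκpos : 0 < min 1 (min (d / 8) (1 / (2 * N))) := by positivity
  set κ : ℝ≥0 := ⟨min 1 (min (d / 8) (1 / (2 * N))), hκpos.le⟩ with hκ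
  have hκ0 : (0 : ℝ) < κ := hκpos
  have hκ1 : (κ : ℝ) ≤ 1 := min_le_left _ _
  have hκd : (κ : ℝ) ≤ d / 8 := (min_le_right _ _).trans (min_le_left _ _)
  have hκN : (κ : ℝ) * N ≤ 1 / 2 := by
    have h1 : (κ : ℝ) ≤ 1 / (2 * N) := (min_le_right _ _).trans (min_le_right _ _)
    rw [le_div_iff₀ (by positivity)] at h1
    linarith
  obtain ⟨δ, hδ, hJ, hsub, hslope⟩ :=
    exists_local_boundary_chart L hΩ.isOpen hΓ.isRelOpen hh hp hρ hL hκ0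
  set t₀ := (L p) 1 with ht₀
  obtain ⟨c₁, hc₁, hcell⟩ := exists_cell_energy_bound L h𝒦 hne m hR0 hR hd_pos
    (by linarith : 2 ≤ N) hNR hh.continuous
  -- The single cell of the coarsest scale spans the whole chart interval, of length `N y₀ = δ`.
  set y₀ : ℝ := δ / N with hy₀
  have hy₀pos : 0 < y₀ := by positivity
  have hNy₀ : N * y₀ = δ := by rw [hy₀]; field_simp
  have hy₀δ : y₀ ≤ δ := by nlinarith
  obtain ⟨c, hc, hlog⟩ := exists_log_lower_bound (mul_pos hc₁ hy₀pos) hy₀pos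
  refine ⟨c, hc, fun ε hε u G g hu hg hosc => ?_⟩
  obtain ⟨hgL, w, hw, -, hwG, hwg⟩ := hg
  obtain ⟨H, hHm, hHi, hGH⟩ :=
    exists_measurable_representative hΩ.isOpen hΩ.isBounded hu.memLp_grad
  have hgrad : ∀ a, Tendsto (fun n => ∫⁻ q in Ω, ‖fderiv ℝ (w n) q a - matVec (H q) a‖ₑ)
      atTop (𝓝 0) := by
    intro a
    refine (tendsto_lintegral_fderiv_sub_matVec hΩ.isBounded.measure_lt_top.ne hw
      (fun i j => (hu.memLp_grad i j).1) hwG a).congr fun n => lintegral_congr_ae ?_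
    filter_upwards [hGH] with q hq
    rw [hq]
  have henergy : energy 𝒦 Ω ε G =
      (∫⁻ q in Ω, distSq (H q) 𝒦) + ENNReal.ofReal ε * totalVariation Ω H := by
    unfold energy
    rw [totalVariation_congr hGH]
    congr 1
    refine lintegral_congr_ae ?_
    filter_upwards [hGH] with q hq
    rw [hq]
  rw [henergy]
  refine hlog ε hε _ _ (sum_cells_le L hh.continuous (t₀ := t₀) (N := N) (m := m) (by linarith)
    hy₀pos hc₁ hHi ?_ ?_)
  · refine (graphSet_mono L h ?_ (Ioo_subset_Ioo_right (by linarith))).trans hsub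
    rw [hNy₀]; exact Ico_subset_Icc_self
  intro t₁ y hy hyy₀ ht₁ ht₁y
  rw [hNy₀] at ht₁y
  have hIcc : Icc t₁ (t₁ + N * y) ⊆ Icc t₀ (t₀ + δ) := Icc_subset_Icc ht₁ ht₁y
  have hIoo : Ioo t₁ (t₁ + N * y) ⊆ Icc t₀ (t₀ + δ) := Ioo_subset_Icc_self.trans hIcc
  have hNy : 0 < N * y := by positivity
  have hℓ : ∀ t ∈ Icc t₁ (t₁ + N * y), |h t - (h t₁ + m * (t - t₁))| ≤ y / 2 := by
    intro t ht
    have h1 := hslope t₁ (hIcc ⟨le_rfl, by linarith⟩) t (hIcc ht)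
    rw [abs_of_nonneg (sub_nonneg.2 ht.1)] at h1
    rw [← sub_sub]
    refine h1.trans ?_
    have h2 : κ * (t - t₁) ≤ κ * (N * y) :=
      mul_le_mul_of_nonneg_left (by linarith [ht.2]) hκ0.le
    nlinarith
  have hCΩ : graphSet L h (Ioo t₁ (t₁ + N * y)) (Ioo 0 (3 * y)) ⊆ Ω :=
    (graphSet_mono L h hIoo (Ioo_subset_Ioo_right (by linarith))).trans hsub
  have hUsub := cell_subset_column L (m := m) hℓ
  refine ⟨hUsub, hcell t₁ y hy hℓ H hHi hHm fun K hK => ?_⟩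
  obtain ⟨hΓ'sub, hΓ'open⟩ := hJ _ hIoo isOpen_Ioo
  have hBc : Continuous fun t => graphMap L h t 0 :=
    (continuous_graphMap L hh.continuous).comp (continuous_id.prodMk continuous_const)
  have hconn : IsConnected ((fun t => graphMap L h t 0) '' Ioo t₁ (t₁ + N * y)) :=
    (isConnected_Ioo (by linarith)).image _ hBc.continuousOn
  have hlow := ae_le_enorm_trace_sub L hh.continuous hy hN8 hd_pos hκ1 hκd
    (fun t ht t' ht' => hslope t (hIoo ht) t' (hIoo ht'))
    (hosc _ hΓ'sub hΓ'open hconn) (hmis K hK)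
  obtain ⟨hγ, hwγ⟩ := tendsto_lintegral_trace L hh.continuous
    (fun t ht => hΓf (hΓ'sub (mem_image_of_mem _ ht))) hw hgL.1 hwg
  exact cell_bound_of_tendsto L hw hh.continuous hy (by linarith) hℓ (matVec K b) hγ hlow
    (measurable_matVec hHm _) (measurable_matVec hHm _) hwγ (hgrad _) (hgrad _)
    (hUsub.trans ((graphSet_mono L h le_rfl (Ioo_subset_Ioo (by linarith) (by linarith))).trans
      hCΩ)) hCΩ
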